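/- **Theorem.** Consider the change-point model $Y=\alpha_0\mathbf 1_{X\le d_0}+\beta_0\mathbf 1_{X>d_0}+\xi$ with $\alpha_0\neq\beta_0$, where $X$ has a density $f_X$ with $f_X(d_0)>0$ and the error $\xi$ is symmetric about $0$ with $\mathbb P(|\xi|>x)=\frac1{1+x^\gamma}$ for all $x\ge 0$, for some $\gamma>0$. Write $\delta=|\alpha_0-\beta_0|$. For a probability law $\nu$ on $\mathbb R$ and $r>0$, let $\mathrm{CPP}(\nu,r)$ be the two-sided compound Poisson process $t\mapsto\sum_{i=1}^{N^+(t)}Z_i$ for $t\ge 0$, $t\mapsto\sum_{i=1}^{N^-(-t)}Z_{-i}$ for $t<0$, where $N^+,N^-$ are independent homogeneous Poisson processes on $[0,\infty)$ of intensity $r$ and $(Z_i)_{i\ne 0}$ are i.i.d. with law $\nu$, independent of $(N^+,N^-)$. The mid argmin of a function on $\mathbb R$ is the midpoint between the infimum and the supremum of its set of global minimizers. Let $F_{\ell_1}$ and $F_{\ell_2}$ be the distribution functions of the mid argmin of $\mathrm{CPP}(\nu,f_X(d_0))$ when $\nu$ is the law of $|\xi+\delta|-|\xi|$, respectively of $\xi+\frac{\delta}{2}$,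 and let $\bar F_{\ell_i}=1-F_{\ell_i}$. (These are the limit laws of $n(\hat d-d_0)$ for the $\ell_1$ and the $\ell_2$ criterion.) Let $\xi_1,\xi_2,\dots$ be i.i.d. copies of $\xi$. 1. Suppose $\gamma>1$ and put $\mu=\delta/2$, $k_0=1\vee\lceil\mu^{-\gamma/(\gamma-1)}\rceil$ and $c_0=\frac{c_1c_2p}{\gamma}$, where $c_1=\frac1{2(1+\mu^{-\gamma})(1+\mu)^\gamma}$, $c_2=\inf_{x\ge1}\left(1-\frac1{1+x}\right)^{x-1}$ and $p=\mathbb P\left(\sum_{j=1}^i(\xi_j+\mu)>0\text{ for all }i\ge1\right)$. Then $c_0>0$, and for all $x\ge\frac{k_0+\gamma+\log 2}{f_X(d_0)}$, $$\bar F_{\ell_2}(x)\ \ge\ \frac{c_0}{2f_X^\gamma(d_0)}\,x^{-\gamma}.$$ 2. Let $\mu_0=\mathbb E\big[|\xi+\delta|-|\xi|\big]$ and $p^*=\mathbb P\left(\sum_{j=1}^i(|\xi_j+\delta|-|\xi_j|)>0\text{ for all }i\ge1\right)$. Then $\mu_0>0$, $p^*>0$, and for all $x>0$, $$\bar F_{\ell_1}(x)\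 \le\ \frac{p^*}{e^{\mu_0^2/(8(\alpha_0-\beta_0)^2)}-1}\,\exp\left(-x f_X(d_0)\left(1-e^{-\mu_0^2/(8(\alpha_0-\beta_0)^2)}\right)\right).$$ -/

import Mathlib

open MeasureTheory ProbabilityTheory
open scoped NNReal ENNReal

noncomputable section

/-- `N` is a homogeneous Poisson process on `[0, ∞)` with intensity `r` under `P`: a counting
process started at `0` whose paths are almost surely nondecreasing, right continuous and have
jumps of size one, with independent increments, where `N t - N s` is Poisson with mean
`r * (t - s)` for `s ≤ t`. -/
structure IsPoissonProcess {Ω : Type*} [MeasurableSpace Ω] (P : Measure Ω) (r : ℝ)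
    (N : ℝ≥0 → Ω → ℕ) : Prop where
  measurable : ∀ t, Measurable (N t)
  zero : ∀ᵐ ω ∂P, N 0 ω = 0
  mono : ∀ᵐ ω ∂P, Monotone fun t => N t ω
  right_cont : ∀ᵐ ω ∂P, ∀ t, ContinuousWithinAt (fun s => N s ω) (Set.Ici t) t
  unit_jumps : ∀ᵐ ω ∂P, ∀ t, 0 < t → ∃ s, s < t ∧ N t ω ≤ N s ω + 1
  indep_increments : HasIndepIncrements N P
  increment_law : ∀ s t, s ≤ t →
    HasLaw (fun ω => N t ω - N s ω) (poissonMeasure (r * ((t : ℝ) - (s : ℝ))).toNNReal) P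

/-- `X` is a two-sided compound Poisson process on `ℝ` with step law `ν` and intensity `r`:
`X t = ∑_{i ≤ N⁺(t)} Z⁺ᵢ` for `t ≥ 0` and `X t = ∑_{i ≤ N⁻(-t)} Z⁻ᵢ` for `t < 0`, where the steps
`Z⁺₁, Z⁺₂, …, Z⁻₁, Z⁻₂, …` are i.i.d. with law `ν` (indexed from `0` here), `N⁺` and `N⁻` are
independent Poisson processes of intensity `r`, and the steps are independent of `(N⁺, N⁻)`. -/
def IsTwoSidedCPP {Ω : Type*} [MeasurableSpace Ω] (P : Measure Ω) (ν : Measure ℝ) (r : ℝ)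
    (X : ℝ → Ω → ℝ) : Prop :=
  ∃ (Npos Nneg : ℝ≥0 → Ω → ℕ) (Zpos Zneg : ℕ → Ω → ℝ),
    IsPoissonProcess P r Npos ∧ IsPoissonProcess P r Nneg ∧
    IndepFun (fun ω t => Npos t ω) (fun ω t => Nneg t ω) P ∧
    (∀ i, Measurable (Zpos i) ∧ HasLaw (Zpos i) ν P) ∧
    (∀ i, Measurable (Zneg i) ∧ HasLaw (Zneg i) ν P) ∧
    iIndepFun (Sum.elim Zpos Zneg) P ∧
    IndepFun (fun ω i => Sum.elim Zpos Zneg i ω)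
      (fun ω => ((fun t => Npos t ω), (fun t => Nneg t ω))) P ∧
    ∀ t ω, X t ω =
      if 0 ≤ t then ∑ i ∈ Finset.range (Npos t.toNNReal ω), Zpos i ω
      else ∑ i ∈ Finset.range (Nneg (-t).toNNReal ω), Zneg i ω

/-- The set of global minimizers of `f : ℝ → ℝ`. -/
def argminSet (f : ℝ → ℝ) : Set ℝ := {t | ∀ s, f t ≤ f s}

/-- The midpoint between the smallest and the largest minimizer: the midpoint of the minimizing
interval when the minimizers form an interval (with or without its end points). -/
def midArgmin (f : ℝ → ℝ) : ℝ := (sInf (argminSet f) + sSup (argminSet f)) / 2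

/-- The distribution function `x ↦ P (mid argmin_t X(t) ≤ x)`. -/
def midArgminCDF {Ω : Type*} [MeasurableSpace Ω] (P : Measure Ω) (X : ℝ → Ω → ℝ) (x : ℝ) : ℝ :=
  P.real {ω | midArgmin (fun t => X t ω) ≤ x}

/-- The law `Q` of an error `ξ` that is symmetric about `0`, with
`P (|ξ| > x) = 1 / (1 + x ^ γ)` for all `x ≥ 0`. -/
structure IsPowerTailErrorLaw (Q : Measure ℝ) (γ : ℝ) : Prop where
  symm : Q.map (fun e => -e) = Q
  tail : ∀ x : ℝ, 0 ≤ x → Q.real {e | x < |e|} = 1 / (1 + x ^ γ)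

/-- For i.i.d. `ξ₁, ξ₂, …` with law `Q`, the probability that the random walk with steps `ψ ξᵢ`
stays positive: `P (ψ ξ₁ + ⋯ + ψ ξₙ > 0 for all n ≥ 1)`. -/
def probWalkPos (Q : Measure ℝ) (ψ : ℝ → ℝ) : ℝ :=
  (Measure.infinitePi fun _ : ℕ => Q).real
    {e | ∀ n, 1 ≤ n → 0 < ∑ i ∈ Finset.range n, ψ (e i)}

/-- The step of the limiting process for the `ℓ₁` criterion, with `δ = |α₀ - β₀|`. -/
def l1Step (δ e : ℝ) : ℝ := |e + δ| - |e|

/-- The step of the limiting process for the `ℓ₂` criterion, with `δ = |α₀ - β₀|`. -/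
def l2Step (δ e : ℝ) : ℝ := e + δ / 2

/-- `k₀ = 1 ∨ ⌈μ ^ (-γ / (γ - 1))⌉`. -/
def k0Const (γ μ : ℝ) : ℝ := max 1 (⌈μ ^ (-γ / (γ - 1))⌉ : ℝ)

/-- `c₁ = 1 / (2 (1 + μ ^ (-γ)) (1 + μ) ^ γ)`. -/
def c1Const (γ μ : ℝ) : ℝ := 1 / (2 * (1 + μ ^ (-γ)) * (1 + μ) ^ γ)

/-- `c₂ = inf_{x ≥ 1} (1 - 1 / (1 + x)) ^ (x - 1)`. -/
def c2Const : ℝ := ⨅ x : Set.Ici (1 : ℝ), (1 - 1 / (1 + (x : ℝ))) ^ ((x : ℝ) - 1)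

/-- `c₀ = c₁ c₂ p / γ`, with `p` the probability that the walk with steps `ξ + μ` stays positive. -/
def c0Const (Q : Measure ℝ) (γ μ : ℝ) : ℝ :=
  c1Const γ μ * c2Const * probWalkPos Q (fun e => e + μ) / γ

end

/-!
The steps of the two-sided process are coded by one i.i.d. family indexed by `ℕ ⊕ ℕ`, independent of
the number `N` of jumps in `[0, x]`, which is Poisson with mean `y = r * x`. Both bounds average over
`N` the probability of an event of the pair of walks (`measureReal_mem_of_indepFun`). Walks with
integrable steps of positive mean tend to infinity, so minimisers exist. The events are compared with
`{mid argmin ≤ x}` by inclusion only, so that the measurability of the latter plays no role.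

**Lower bound.** Put `m = N + 1`. If the right-hand walk `S` has a strict record minimum at time `m`
and `S (m + ·) - S m` has a minimum at most that of the left-hand walk, then all minimisers lie beyond
`x` (`lt_midArgmin_stepPath`). The two conditions are independent, and by symmetry between two i.i.d.
walks the second has probability at least `1 / 2`. The record has probability at least
`P (S m < 0) / m` by the cyclic lemma (`measureReal_neg_le_mul_strictRecord`). With `ξ` symmetric and
`u = P (|ξ| > m * μ)`, a Lévy inequality based on the first `|ξ i| > m * μ` gives
`P (S m < 0) ≥ (1 - (1 - u) ^ m) / 4 ≥ m * u / (4 * (1 + m * u))`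
(`measureReal_firstBigNeg_le`), so the factor `1 / m` cancels and the record has probability of order
`m ^ (-γ)`. Finally `E (N + 1) ^ (-γ) ≥ ((1 - exp (-y)) / y) ^ γ` by Jensen's inequality, and the
constants compare because `2 * c₂ ≤ (1 - exp (-y)) ^ γ` for `y ≥ 1 + γ + log 2`.

**Upper bound.** If the mid argmin exceeds `x`, some minimiser does, so the last minimiser `k` of
`S` satisfies `k ≥ N`, `S k ≤ 0` and `S j > S k` for `j > k`. For fixed `k` this has probability
`p* * P (S k ≤ 0)`, and Hoeffding's inequality bounds the last factor by `q ^ (4 * k)`, where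
`q = exp (-μ₀ ^ 2 / (8 * δ ^ 2))`. Summing over `k ≥ N` and taking the generating function of the
Poisson law gives the claim, as `1 / (1 - q ^ 4) ≤ q / (1 - q)`.

The walk stays positive with positive probability because each time is its last minimiser with
the same or smaller probability, and some time is (`posProb_pos`).
-/

/-! ### Random walks with i.i.d. steps -/

/-- The random walk with steps `z`, started at `0`. -/
def walkSum (z : ℕ → ℝ) (n : ℕ) : ℝ := ∑ i ∈ Finset.range n, z i

@[simp] lemma walkSum_zero (z : ℕ → ℝ) : walkSum z 0 = 0 := by simp [walkSum]

lemma walkSum_add (z : ℕ → ℝ) (m n : ℕ) :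
    walkSum z (m + n) = walkSum z m + walkSum (fun i => z (m + i)) n :=
  Finset.sum_range_add _ _ _

@[fun_prop] lemma measurable_walkSum (n : ℕ) : Measurable fun z => walkSum z n := by
  unfold walkSum; fun_prop

/-- The law of an i.i.d. family with common law `ν`. -/
noncomputable abbrev iidLaw (ι : Type*) (ν : Measure ℝ) : Measure (ι → ℝ) :=
  Measure.infinitePi fun _ => ν

section iid

variable {ι : Type*} (ν : Measure ℝ) [IsProbabilityMeasure ν]

lemma measurePreserving_iidLaw_comp {κ : Type*} {g : κ → ι} (hg : g.Injective) :
    MeasurePreserving (fun (e : ι → ℝ) k => e (g k)) (iidLaw ι ν) (iidLaw κ ν) :=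
  ⟨by fun_prop, Measure.map_infinitePi_infinitePi_of_inj hg⟩

lemma measurePreserving_iidLaw_map {ψ : ℝ → ℝ} (hψ : Measurable ψ) :
    MeasurePreserving (fun (e : ι → ℝ) i => ψ (e i)) (iidLaw ι ν) (iidLaw ι (ν.map ψ)) :=
  ⟨by fun_prop, Measure.infinitePi_map_pi (fun _ => ν) (fun _ => hψ)⟩

lemma comap_block_le {κ : Type*} (g : κ → ι) :
    MeasurableSpace.comap (fun (e : ι → ℝ) k => e (g k)) inferInstance ≤
      ⨆ i ∈ Set.range g, MeasurableSpace.comap (fun e : ι → ℝ => e i) inferInstance := by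
  rw [MeasurableSpace.pi, MeasurableSpace.comap_iSup]
  refine iSup_le fun k => ?_
  rw [MeasurableSpace.comap_comp]
  exact le_iSup₂_of_le (g k) ⟨k, rfl⟩ le_rfl

/-- Disjoint blocks of an i.i.d. family are independent. -/
lemma indepFun_blocks {κ κ' : Type*} (g : κ → ι) (h : κ' → ι)
    (hgh : Disjoint (Set.range g) (Set.range h)) :
    IndepFun (fun (e : ι → ℝ) k => e (g k)) (fun (e : ι → ℝ) k => e (h k)) (iidLaw ι ν) := by
  have hi : iIndepFun (fun (i : ι) (e : ι → ℝ) => e i) (iidLaw ι ν) :=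
    iIndepFun_infinitePi (X := fun _ x => x) (by fun_prop)
  have key := indep_iSup_of_disjoint (fun i => (measurable_pi_apply i).comap_le) hi hgh
  rw [IndepFun_iff_Indep]
  exact indep_of_indep_of_le_left (indep_of_indep_of_le_right key (comap_block_le h)) (comap_block_le g)

end iid

section walk

variable (ν : Measure ℝ) [IsProbabilityMeasure ν]

lemma ae_tendsto_walkSum (hint : Integrable (fun x => x) ν) (hpos : 0 < ∫ x, x ∂ν) :
    ∀ᵐ z ∂iidLaw ℕ ν, Filter.Tendsto (walkSum z) Filter.atTop Filter.atTop := by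
  have hmp : ∀ i, MeasurePreserving (fun z : ℕ → ℝ => z i) (iidLaw ℕ ν) ν :=
    fun i => measurePreserving_eval_infinitePi (fun _ => ν) i
  have hi : iIndepFun (fun (i : ℕ) (e : ℕ → ℝ) => e i) (iidLaw ℕ ν) :=
    iIndepFun_infinitePi (X := fun _ x => x) (by fun_prop)
  have h := strong_law_ae_real (fun (i : ℕ) (z : ℕ → ℝ) => z i)
    ((hmp 0).integrable_comp_of_integrable hint) (fun i j hij => hi.indepFun hij)
    (fun i => ⟨(hmp i).aemeasurable, (hmp 0).aemeasurable, by rw [(hmp i).map_eq, (hmp 0).map_eq]⟩)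
  have hE : ∫ z, z 0 ∂iidLaw ℕ ν = ∫ x, x ∂ν := by
    conv_rhs => rw [← (hmp 0).map_eq]
    rw [integral_map (hmp 0).aemeasurable (by fun_prop)]
  rw [hE] at h
  filter_upwards [h] with z hz
  have h2 := hz.pos_mul_atTop hpos (tendsto_natCast_atTop_atTop (R := ℝ))
  refine h2.congr' ?_
  filter_upwards [Filter.eventually_gt_atTop 0] with n hn
  have : (n : ℝ) ≠ 0 := by positivity
  simp [walkSum, this]

/-- The probability that the walk with step law `ν` stays positive. -/
noncomputable def posProb : ℝ := (iidLaw ℕ ν).real {z | ∀ n, 1 ≤ n → 0 < walkSum z n}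

lemma measurableSet_walkPos : MeasurableSet {z : ℕ → ℝ | ∀ n, 1 ≤ n → 0 < walkSum z n} := by
  simp only [Set.ofPred_forall]
  exact .iInter fun n => .iInter fun _ => measurableSet_lt (by fun_prop) (by fun_prop)

lemma probWalkPos_eq_posProb {ψ : ℝ → ℝ} (hψ : Measurable ψ) :
    probWalkPos ν ψ = posProb (ν.map ψ) := by
  have := Measure.isProbabilityMeasure_map (μ := ν) hψ.aemeasurable
  rw [posProb, ← (measurePreserving_iidLaw_map ν hψ).measureReal_preimage
    measurableSet_walkPos.nullMeasurableSet]
  rfl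

/-- The walks whose value at time `k` is strictly below all later values. -/
def strictLater (k : ℕ) : Set (ℕ → ℝ) := {z | ∀ j, k < j → walkSum z k < walkSum z j}

lemma strictLater_eq (k : ℕ) :
    strictLater k = (fun (z : ℕ → ℝ) i => z (k + i)) ⁻¹' {z | ∀ n, 1 ≤ n → 0 < walkSum z n} := by
  ext z
  simp only [strictLater, Set.mem_ofPred_eq, Set.mem_preimage]
  constructor
  · intro h n hn
    have := h (k + n) (by omega)
    rw [walkSum_add] at this
    linarith
  · intro h j hj
    obtain ⟨n, rfl⟩ := Nat.exists_eq_add_of_lt hj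
    rw [add_assoc, walkSum_add]
    linarith [h (n + 1) (by omega)]

lemma measurableSet_strictLater (k : ℕ) : MeasurableSet (strictLater k) := by
  rw [strictLater_eq]
  exact measurableSet_preimage (by fun_prop) measurableSet_walkPos

lemma measureReal_strictLater (k : ℕ) : (iidLaw ℕ ν).real (strictLater k) = posProb ν := by
  rw [strictLater_eq, (measurePreserving_iidLaw_comp ν (add_right_injective k)).measureReal_preimage
    measurableSet_walkPos.nullMeasurableSet, posProb]

/-- A sequence tending to infinity has a last minimiser. -/
lemma exists_last_min {s : ℕ → ℝ} (hs : Filter.Tendsto s Filter.atTop Filter.atTop) :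
    ∃ k, (∀ j, s k ≤ s j) ∧ ∀ j, k < j → s k < s j := by
  obtain ⟨k₀, hk₀⟩ : ∃ k₀, ∀ j, s k₀ ≤ s j := by
    obtain ⟨N, hN⟩ := Filter.eventually_atTop.1 (hs.eventually_ge_atTop (s 0))
    obtain ⟨k, -, hk⟩ := Finset.exists_min_image (Finset.range (N + 1)) s ⟨0, by simp⟩
    refine ⟨k, fun j => ?_⟩
    by_cases hj : j < N + 1
    · exact hk j (by simpa using hj)
    · exact (hk 0 (by simp)).trans (hN j (by omega))
  obtain ⟨N, hN⟩ := Filter.eventually_atTop.1 (hs.eventually_gt_atTop (s k₀))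
  classical
  have hbd : ∀ j, s j ≤ s k₀ → j ≤ N := fun j hj => by
    by_contra h
    exact absurd hj (not_le.2 (hN j (by omega)))
  refine ⟨Nat.findGreatest (fun j => s j ≤ s k₀) N, ?_, ?_⟩
  · have := Nat.findGreatest_spec (P := fun j => s j ≤ s k₀) (hbd k₀ le_rfl) le_rfl
    exact fun j => this.trans (hk₀ j)
  · have h1 := Nat.findGreatest_spec (P := fun j => s j ≤ s k₀) (hbd k₀ le_rfl) le_rfl
    intro j hj
    by_contra hcon
    have h2 : s j ≤ s k₀ := (not_lt.1 hcon).trans h1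
    exact absurd (Nat.le_findGreatest (hbd j h2) h2) (not_le.2 hj)

/-- A random walk with positive drift has positive probability to stay positive: it has a last
minimiser almost surely, and each time is the last minimiser with at most this probability. -/
lemma posProb_pos (hint : Integrable (fun x => x) ν) (hpos : 0 < ∫ x, x ∂ν) :
    0 < posProb ν := by
  refine lt_of_le_of_ne measureReal_nonneg fun h0 => ?_
  have hk : ∀ k, iidLaw ℕ ν (strictLater k) = 0 := fun k => by
    have := measureReal_strictLater ν k
    rw [← h0] at this
    exact (measureReal_eq_zero_iff).1 this
  have h1 : iidLaw ℕ ν (⋃ k, strictLater k) = 0 := measure_iUnion_null hk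
  have h2 : ∀ᵐ z ∂iidLaw ℕ ν, z ∈ ⋃ k, strictLater k := by
    filter_upwards [ae_tendsto_walkSum ν hint hpos] with z hz
    obtain ⟨k, -, hk⟩ := exists_last_min hz
    exact Set.mem_iUnion.2 ⟨k, hk⟩
  have h3 : ∀ᵐ z ∂iidLaw ℕ ν, False := by
    filter_upwards [h2, measure_eq_zero_iff_ae_notMem.1 h1] with z hz hz' using hz' hz
  simpa using h3.exists

lemma measureReal_strictLater_inter (k : ℕ) :
    (iidLaw ℕ ν).real (strictLater k ∩ {z | walkSum z k ≤ 0}) =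
      posProb ν * (iidLaw ℕ ν).real {z | walkSum z k ≤ 0} := by
  have hind := indepFun_blocks ν (fun i : ℕ => k + i) (fun i : Fin k => (i : ℕ)) (by
    rw [Set.disjoint_left]
    rintro _ ⟨i, rfl⟩ ⟨j, hj⟩
    have := j.2
    simp only at hj
    omega)
  have hB : {z : ℕ → ℝ | walkSum z k ≤ 0} =
      (fun (z : ℕ → ℝ) (i : Fin k) => z i) ⁻¹' {y | ∑ i, y i ≤ 0} := by
    ext z
    simp [walkSum, Finset.sum_range]
  have := hind.measure_inter_preimage_eq_mul _ {y : Fin k → ℝ | ∑ i, y i ≤ 0} measurableSet_walkPos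
    (measurableSet_le (by fun_prop) (by fun_prop))
  rw [← hB, ← strictLater_eq] at this
  rw [← measureReal_strictLater ν k, measureReal_def, this, ENNReal.toReal_mul]
  rfl

end walk

/-! ### Record minima and the cyclic lemma -/

section record

/-- The walks with a strict record minimum at time `m`: the value at time `m` is strictly below
all earlier values, the starting value `0` included. -/
def strictRecord (m : ℕ) : Set (ℕ → ℝ) := {z | ∀ j, j < m → walkSum z m < walkSum z j}

lemma measurableSet_strictRecord (m : ℕ) : MeasurableSet (strictRecord m) := by
  simp only [strictRecord, Set.ofPred_forall]
  exact .iInter fun n => .iInter fun _ => measurableSet_lt (by fun_prop) (by fun_prop)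

/-- Cyclic rotation by `i` of the indices below `m`. -/
def rotateIndex (m i n : ℕ) : ℕ := if n < m then (n + i) % m else n

lemma rotateIndex_injective {m i : ℕ} : (rotateIndex m i).Injective := by
  intro a b hab
  unfold rotateIndex at hab
  split_ifs at hab with ha hb hb
  · have : a ≡ b [MOD m] := Nat.ModEq.add_right_cancel' i hab
    rwa [Nat.ModEq, Nat.mod_eq_of_lt ha, Nat.mod_eq_of_lt hb] at this
  · have := Nat.mod_lt (a + i) (by omega : 0 < m)
    omega
  · have := Nat.mod_lt (b + i) (by omega : 0 < m)
    omega
  · exact hab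

lemma walkSum_rotate_of_le {m i j : ℕ} (hij : i + j ≤ m) (z : ℕ → ℝ) :
    walkSum z i + walkSum (fun n => z (rotateIndex m i n)) j = walkSum z (i + j) := by
  rw [walkSum_add]
  congr 1
  refine Finset.sum_congr rfl fun n hn => ?_
  have := Finset.mem_range.1 hn
  have hr : rotateIndex m i n = i + n := by
    rw [rotateIndex, if_pos (by omega), Nat.mod_eq_of_lt (by omega), add_comm]
  simp only [hr]

lemma walkSum_rotate_of_ge {m i l : ℕ} (hi : i ≤ m) (hl : l ≤ i) (z : ℕ → ℝ) :
    walkSum z i + walkSum (fun n => z (rotateIndex m i n)) (m - i + l) =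
      walkSum z m + walkSum z l := by
  have h1 := walkSum_rotate_of_le (i := i) (j := m - i) (m := m) (by omega) z
  rw [Nat.add_sub_cancel' hi] at h1
  rw [walkSum_add _ (m - i) l, ← add_assoc, h1]
  congr 1
  refine Finset.sum_congr rfl fun n hn => ?_
  have := Finset.mem_range.1 hn
  have hr : rotateIndex m i (m - i + n) = n := by
    rw [rotateIndex, if_pos (by omega), show m - i + n + i = n + m by omega, Nat.add_mod_right,
      Nat.mod_eq_of_lt (by omega)]
  simp only [hr]

/-- If the walk is negative at time `m`, then rotating its first `m` steps so that they end with
the first minimum yields a walk with a strict record at time `m`. -/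
lemma exists_rotate_mem_strictRecord {m : ℕ} {z : ℕ → ℝ} (hz : walkSum z m < 0) :
    ∃ i ∈ Finset.range m, (fun n => z (rotateIndex m (i + 1) n)) ∈ strictRecord m := by
  classical
  have hex : ∃ i, i ≤ m ∧ ∀ j ≤ m, walkSum z i ≤ walkSum z j := by
    obtain ⟨k, hk, hk'⟩ :=
      Finset.exists_min_image (Finset.range (m + 1)) (walkSum z) ⟨0, by simp⟩
    exact ⟨k, by simpa [Nat.lt_succ_iff] using hk, fun j hj => hk' j (by simp; omega)⟩
  set i := Nat.find hex with hi
  obtain ⟨him, hmin⟩ : i ≤ m ∧ ∀ j ≤ m, walkSum z i ≤ walkSum z j := Nat.find_spec hex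
  have hfirst : ∀ l < i, walkSum z i < walkSum z l := fun l hl => by
    by_contra hcon
    exact Nat.find_min hex hl ⟨by omega, fun j hj => (not_lt.1 hcon).trans (hmin j hj)⟩
  have hi0 : i ≠ 0 := fun h0 => by
    have := hmin m le_rfl
    rw [h0, walkSum_zero] at this
    linarith
  refine ⟨i - 1, Finset.mem_range.2 (by omega), ?_⟩
  rw [Nat.sub_add_cancel (by omega)]
  intro j hj
  have hm := walkSum_rotate_of_ge him le_rfl z
  rw [Nat.sub_add_cancel him] at hm
  rcases le_or_gt (i + j) m with h | h
  · have h1 := walkSum_rotate_of_le h z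
    have h2 := hmin (i + j) h
    linarith
  · obtain ⟨l, rfl⟩ : ∃ l, j = m - i + l := ⟨j - (m - i), by omega⟩
    have h1 := walkSum_rotate_of_ge him (l := l) (by omega) z
    have h2 := hfirst l (by omega)
    linarith

/-- The cyclic lemma: a walk negative at time `m` has a strict record at time `m` after one of the
`m` rotations of its first `m` steps, and rotations preserve the law. -/
lemma measureReal_neg_le_mul_strictRecord (ν : Measure ℝ) [IsProbabilityMeasure ν] (m : ℕ) :
    (iidLaw ℕ ν).real {z | walkSum z m < 0} ≤ m * (iidLaw ℕ ν).real (strictRecord m) := by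
  have hsub : {z | walkSum z m < 0} ⊆ ⋃ i ∈ Finset.range m,
      (fun (z : ℕ → ℝ) n => z (rotateIndex m (i + 1) n)) ⁻¹' strictRecord m := fun z hz => by
    obtain ⟨i, hi, h⟩ := exists_rotate_mem_strictRecord hz
    exact Set.mem_biUnion hi h
  refine (measureReal_mono hsub (measure_ne_top _ _)).trans
    ((measureReal_biUnion_finset_le _ _).trans ?_)
  rw [Finset.sum_congr rfl fun i _ =>
    (measurePreserving_iidLaw_comp ν rotateIndex_injective).measureReal_preimage
      (measurableSet_strictRecord m).nullMeasurableSet]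
  simp

end record

/-! ### A Lévy inequality for symmetric summands -/

section signFlip

/-- Flip the sign of every coordinate except the `i`-th. -/
def flipExcept (i : ℕ) (e : ℕ → ℝ) (j : ℕ) : ℝ := if j = i then e j else -e j

lemma measurePreserving_flipExcept {Q : Measure ℝ} [IsProbabilityMeasure Q]
    (hQ : Q.map (fun e => -e) = Q) (i : ℕ) :
    MeasurePreserving (flipExcept i) (iidLaw ℕ Q) (iidLaw ℕ Q) := by
  have hm : ∀ j, Measurable fun x : ℝ => if j = i then x else -x := fun j => by
    split_ifs <;> fun_prop
  refine ⟨measurable_pi_iff.2 fun j => (hm j).comp (measurable_pi_apply j), ?_⟩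
  refine (Measure.infinitePi_map_pi (fun _ => Q) hm).trans ?_
  congr 1
  ext1 j
  by_cases h : j = i <;> simp [h, hQ]

/-- The first coordinate of absolute value above `t` is the `i`-th, and it is negative
(for `t ≥ 0`). -/
def firstBigNeg (t : ℝ) (i : ℕ) : Set (ℕ → ℝ) :=
  {e | e i < -t ∧ ∀ j, j < i → |e j| ≤ t}

lemma firstBigNeg_eq_pi (t : ℝ) (i : ℕ) :
    firstBigNeg t i = (Finset.range (i + 1) : Set ℕ).pi
      fun j => if j = i then {x | x < -t} else {x | |x| ≤ t} := by
  ext e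
  simp only [firstBigNeg, Set.mem_ofPred_eq, Set.mem_pi, Finset.coe_range, Set.mem_Iio]
  constructor
  · rintro ⟨h1, h2⟩ j hj
    split_ifs with h
    · exact h ▸ h1
    · exact h2 j (by omega)
  · intro h
    refine ⟨by simpa using h i (by omega), fun j hj => ?_⟩
    simpa [hj.ne] using h j (by omega)

lemma measurableSet_firstBigNeg (t : ℝ) (i : ℕ) : MeasurableSet (firstBigNeg t i) := by
  rw [firstBigNeg_eq_pi]
  refine .pi (Finset.countable_toSet _) fun j _ => ?_
  split_ifs
  · exact measurableSet_Iio
  · exact measurableSet_le (by fun_prop) (by fun_prop)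

lemma measureReal_firstBigNeg (Q : Measure ℝ) [IsProbabilityMeasure Q] (t : ℝ) (i : ℕ) :
    (iidLaw ℕ Q).real (firstBigNeg t i) = Q.real {x | x < -t} * Q.real {x | |x| ≤ t} ^ i := by
  rw [firstBigNeg_eq_pi, measureReal_def, Measure.infinitePi_pi, Finset.prod_range_succ,
    Finset.prod_congr rfl (g := fun _ => Q {x | |x| ≤ t})]
  · simp [measureReal_def, mul_comm]
  · intro j hj
    rw [if_neg (Finset.mem_range.1 hj).ne]
  · intro j _
    split_ifs
    · exact measurableSet_Iio
    · exact measurableSet_le (by fun_prop) (by fun_prop)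

/-- A one-sided Lévy inequality. If `e i < -t`, the sum of the first `m` coordinates or the same sum
with all signs but the `i`-th flipped is below `-t`, as the two add up to `2 * e i`. -/
lemma measureReal_firstBigNeg_le {Q : Measure ℝ} [IsProbabilityMeasure Q]
    (hQ : Q.map (fun e => -e) = Q) (t : ℝ) {i m : ℕ} (him : i < m) :
    (iidLaw ℕ Q).real (firstBigNeg t i) ≤
      2 * (iidLaw ℕ Q).real (firstBigNeg t i ∩ {e | walkSum e m < -t}) := by
  set A := firstBigNeg t i ∩ {e | walkSum e m < -t} with hA
  have hAm : MeasurableSet A :=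
    (measurableSet_firstBigNeg t i).inter (measurableSet_lt (by fun_prop) (by fun_prop))
  have hsub : firstBigNeg t i ⊆ A ∪ flipExcept i ⁻¹' A := by
    intro e he
    by_cases h : walkSum e m < -t
    · exact Or.inl ⟨he, h⟩
    · refine Or.inr ⟨⟨?_, fun j hj => ?_⟩, ?_⟩
      · simpa [flipExcept] using he.1
      · simpa [flipExcept, hj.ne] using he.2 j hj
      · have hsum : walkSum e m + walkSum (flipExcept i e) m = 2 * e i := by
          rw [walkSum, walkSum, ← Finset.sum_add_distrib,
            Finset.sum_eq_single_of_mem i (Finset.mem_range.2 him)]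
          · simp [flipExcept]; ring
          · intro j _ hj
            simp [flipExcept, hj]
        have h1 := he.1
        have h2 := not_lt.1 h
        change walkSum (flipExcept i e) m < -t
        linarith
  calc _ ≤ (iidLaw ℕ Q).real (A ∪ flipExcept i ⁻¹' A) := measureReal_mono hsub
    _ ≤ _ := measureReal_union_le _ _
    _ = _ := by
      rw [(measurePreserving_flipExcept hQ i).measureReal_preimage hAm.nullMeasurableSet]
      ring

lemma sum_firstBigNeg_le {Q : Measure ℝ} [IsProbabilityMeasure Q]
    (hQ : Q.map (fun e => -e) = Q) (t : ℝ) (m : ℕ) :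
    ∑ i ∈ Finset.range m, Q.real {x | x < -t} * Q.real {x | |x| ≤ t} ^ i ≤
      2 * (iidLaw ℕ Q).real {e | walkSum e m < -t} := by
  calc _ ≤ ∑ i ∈ Finset.range m,
        2 * (iidLaw ℕ Q).real (firstBigNeg t i ∩ {e | walkSum e m < -t}) := by
        refine Finset.sum_le_sum fun i hi => ?_
        rw [← measureReal_firstBigNeg]
        exact measureReal_firstBigNeg_le hQ t (Finset.mem_range.1 hi)
    _ = 2 * (iidLaw ℕ Q).real
        (⋃ i ∈ Finset.range m, firstBigNeg t i ∩ {e | walkSum e m < -t}) := by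
        rw [← Finset.mul_sum, measureReal_biUnion_finset]
        · intro i _ j _ hij
          refine Set.disjoint_left.2 fun e he he' => ?_
          have aux : ∀ {a b : ℕ}, a < b → e ∈ firstBigNeg t a → e ∈ firstBigNeg t b → False :=
            fun {a b} hab ha hb => by
              have h1 := ha.1
              have h2 := abs_le.1 (hb.2 a hab)
              linarith [h2.1]
          rcases lt_or_gt_of_ne hij with h | h
          · exact aux h he.1 he'.1
          · exact aux h he'.1 he.1
        · exact fun i _ => (measurableSet_firstBigNeg t i).inter
            (measurableSet_lt (by fun_prop) (by fun_prop))
    _ ≤ _ := by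
        gcongr
        · exact measure_ne_top _ _
        · exact Set.iUnion₂_subset fun i _ => Set.inter_subset_right

end signFlip

/-! ### Comparison of two walks -/

section twoSided

/-- For a pair of walks, coded by a family indexed by `ℕ ⊕ ℕ`: every value of the second walk is at
least some value of the first. When the walks have minima, this says that the minimum of the first
walk is at most that of the second. -/
def dominated : Set (ℕ ⊕ ℕ → ℝ) :=
  {e | ∀ i, ∃ j, walkSum (fun n => e (.inl n)) j ≤ walkSum (fun n => e (.inr n)) i}

lemma measurable_walkSum_comp {ι : Type*} (g : ℕ → ι) (n : ℕ) :
    Measurable fun e : ι → ℝ => walkSum (fun k => e (g k)) n := by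
  unfold walkSum; fun_prop

lemma measurableSet_dominated : MeasurableSet dominated := by
  simp only [dominated, Set.ofPred_forall, Set.ofPred_exists]
  exact .iInter fun n => .iUnion fun _ =>
    measurableSet_le (measurable_walkSum_comp _ _) (measurable_walkSum_comp _ _)

/-- Of two i.i.d. walks at least one dominates the other, so by exchangeability domination has
probability at least one half. -/
lemma half_le_measureReal_dominated (ν : Measure ℝ) [IsProbabilityMeasure ν] :
    1 / 2 ≤ (iidLaw (ℕ ⊕ ℕ) ν).real dominated := by
  have hsub : (Set.univ : Set (ℕ ⊕ ℕ → ℝ)) ⊆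
      dominated ∪ (fun (e : ℕ ⊕ ℕ → ℝ) k => e (Sum.swap k)) ⁻¹' dominated := by
    intro e _
    by_cases h : e ∈ dominated
    · exact Or.inl h
    · refine Or.inr fun i => ?_
      simp only [dominated, Set.mem_ofPred_eq, not_forall, not_exists, not_le] at h
      obtain ⟨j, hj⟩ := h
      exact ⟨j, (hj i).le⟩
  have h1 := (measureReal_mono (μ := iidLaw (ℕ ⊕ ℕ) ν) hsub (measure_ne_top _ _)).trans
    (measureReal_union_le _ _)
  rw [(measurePreserving_iidLaw_comp ν Sum.swap_leftInverse.injective).measureReal_preimage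
    measurableSet_dominated.nullMeasurableSet, probReal_univ] at h1
  linarith

/-- The indices that remain after removing the first `m` ones on the left. -/
def shiftLeft (m : ℕ) : ℕ ⊕ ℕ → ℕ ⊕ ℕ := Sum.map (m + ·) id

/-- The first walk has a strict record minimum at time `m`, and restarted from there it dominates
the second walk. -/
def recordDominated (m : ℕ) : Set (ℕ ⊕ ℕ → ℝ) :=
  {e | (fun n => e (.inl n)) ∈ strictRecord m} ∩
    (fun (e : ℕ ⊕ ℕ → ℝ) k => e (shiftLeft m k)) ⁻¹' dominated

lemma measurableSet_recordDominated (m : ℕ) : MeasurableSet (recordDominated m) :=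
  (measurableSet_preimage (f := fun (e : ℕ ⊕ ℕ → ℝ) n => e (.inl n)) (by fun_prop)
    (measurableSet_strictRecord m)).inter
    (measurableSet_preimage (by fun_prop) measurableSet_dominated)

lemma half_mul_le_measureReal_recordDominated (ν : Measure ℝ) [IsProbabilityMeasure ν] (m : ℕ) :
    1 / 2 * (iidLaw ℕ ν).real (strictRecord m) ≤
      (iidLaw (ℕ ⊕ ℕ) ν).real (recordDominated m) := by
  have hind := indepFun_blocks ν (fun i : Fin m => (.inl (i : ℕ) : ℕ ⊕ ℕ)) (shiftLeft m) (by
    rw [Set.disjoint_left]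
    rintro _ ⟨i, rfl⟩ ⟨j, hj⟩
    have := i.2
    rcases j with j | j <;> simp [shiftLeft] at hj
    omega)
  -- The record event only involves the first `m` steps, so the others may be replaced by `0`.
  set ext : (Fin m → ℝ) → ℕ → ℝ := fun y i => if h : i < m then y ⟨i, h⟩ else 0 with hext
  have hextm : Measurable ext := measurable_pi_iff.2 fun i => by
    simp only [hext]
    split_ifs <;> fun_prop
  have hB : {e : ℕ ⊕ ℕ → ℝ | (fun n => e (.inl n)) ∈ strictRecord m} =
      (fun (e : ℕ ⊕ ℕ → ℝ) (i : Fin m) => e (.inl i)) ⁻¹' (ext ⁻¹' strictRecord m) := by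
    ext e
    have hw : ∀ j ≤ m, walkSum (ext fun i : Fin m => e (.inl i)) j =
        walkSum (fun n => e (.inl n)) j := fun j hj =>
      Finset.sum_congr rfl fun n hn => by
        have := Finset.mem_range.1 hn
        simp [hext, show n < m by omega]
    simp only [strictRecord, Set.mem_ofPred_eq, Set.mem_preimage]
    refine forall₂_congr fun j hj => ?_
    rw [hw m le_rfl, hw j hj.le]
  have := hind.measure_inter_preimage_eq_mul _ _
    (measurableSet_preimage hextm (measurableSet_strictRecord m)) measurableSet_dominated
  rw [← hB] at this
  have hinj : (shiftLeft m).Injective :=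
    Sum.map_injective.2 ⟨add_right_injective m, Function.injective_id⟩
  have h1 : iidLaw (ℕ ⊕ ℕ) ν {e | (fun n => e (.inl n)) ∈ strictRecord m} =
      iidLaw ℕ ν (strictRecord m) :=
    (measurePreserving_iidLaw_comp ν Sum.inl_injective).measure_preimage
      (measurableSet_strictRecord m).nullMeasurableSet
  have h2 : iidLaw (ℕ ⊕ ℕ) ν ((fun (e : ℕ ⊕ ℕ → ℝ) k => e (shiftLeft m k)) ⁻¹' dominated) =
      iidLaw (ℕ ⊕ ℕ) ν dominated :=
    (measurePreserving_iidLaw_comp ν hinj).measure_preimage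
      measurableSet_dominated.nullMeasurableSet
  have h3 : (iidLaw (ℕ ⊕ ℕ) ν).real (recordDominated m) =
      (iidLaw (ℕ ⊕ ℕ) ν).real dominated * (iidLaw ℕ ν).real (strictRecord m) := by
    rw [recordDominated, measureReal_def, this, h1, h2, ENNReal.toReal_mul, mul_comm]
    rfl
  rw [h3]
  gcongr
  exact half_le_measureReal_dominated ν

end twoSided

/-! ### Poisson laws and Poisson processes -/

section poisson

lemma integral_pow_poissonMeasure (r : ℝ≥0) (s : ℝ) :
    ∫ n, s ^ n ∂poissonMeasure r = Real.exp (-(r * (1 - s))) := by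
  rw [integral_poissonMeasure]
  have h := (NormedSpace.expSeries_div_hasSum_exp ((r : ℝ) * s)).mul_left (Real.exp (-r))
  rw [← Real.exp_eq_exp_ℝ, ← Real.exp_add] at h
  rw [show -(r * (1 - s)) = -(r : ℝ) + r * s by ring, ← h.tsum_eq]
  congr with n
  rw [smul_eq_mul, mul_pow]
  ring

lemma integral_inv_succ_poissonMeasure {r : ℝ≥0} (hr : 0 < r) :
    ∫ n : ℕ, ((n : ℝ) + 1)⁻¹ ∂poissonMeasure r = (1 - Real.exp (-r)) / r := by
  rw [integral_poissonMeasure]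
  have hr' : (r : ℝ) ≠ 0 := by exact_mod_cast hr.ne'
  have h := NormedSpace.expSeries_div_hasSum_exp (r : ℝ)
  rw [← Real.exp_eq_exp_ℝ, ← hasSum_nat_add_iff' 1] at h
  have h2 := (h.mul_left (Real.exp (-r) / r)).tsum_eq
  have h3 : Real.exp (-r) / r * (Real.exp r - ∑ i ∈ Finset.range 1, (r : ℝ) ^ i / (i.factorial : ℝ))
      = (1 - Real.exp (-r)) / r := by
    have : Real.exp (-(r : ℝ)) * Real.exp r = 1 := by rw [← Real.exp_add]; simp
    simp only [Finset.range_one, Finset.sum_singleton, pow_zero, Nat.factorial_zero, Nat.cast_one,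
      div_one]
    rw [div_mul_eq_mul_div, mul_sub, this, mul_one]
  rw [← h3, ← h2]
  congr with n
  rw [smul_eq_mul, Nat.factorial_succ, pow_succ]
  have : (n.factorial : ℝ) ≠ 0 := by positivity
  have : (n : ℝ) + 1 ≠ 0 := by positivity
  push_cast
  field_simp

lemma poissonMeasure_real_le_le (r : ℝ≥0) (k : ℕ) :
    (poissonMeasure r).real {n | n ≤ k} ≤ 2 ^ k * Real.exp (-(r / 2)) := by
  have hint : Integrable (fun n : ℕ => (1 / 2 : ℝ) ^ n) (poissonMeasure r) :=
    .of_bound (C := 1) (by fun_prop) (.of_forall fun n => by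
      rw [Real.norm_of_nonneg (by positivity)]
      exact pow_le_one₀ (by norm_num) (by norm_num))
  have h := mul_meas_ge_le_integral_of_nonneg (.of_forall fun n => by positivity) hint
    ((1 / 2 : ℝ) ^ k)
  have hset : {n : ℕ | (1 / 2 : ℝ) ^ k ≤ (1 / 2 : ℝ) ^ n} = {n | n ≤ k} := by
    ext n
    exact pow_le_pow_iff_right_of_lt_one₀ (a := (1 / 2 : ℝ)) (by norm_num) (by norm_num)
  rw [hset, integral_pow_poissonMeasure] at h
  calc (poissonMeasure r).real {n | n ≤ k}
      = 2 ^ k * ((1 / 2) ^ k * (poissonMeasure r).real {n | n ≤ k}) := by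
        rw [← mul_assoc, ← mul_pow]; norm_num
    _ ≤ 2 ^ k * Real.exp (-(r * (1 - 1 / 2))) := by gcongr
    _ = _ := by congr 2; ring

variable {Ω : Type*} [MeasurableSpace Ω] {P : Measure Ω} {r : ℝ}
  {N : ℝ≥0 → Ω → ℕ}

lemma IsPoissonProcess.hasLaw (hN : IsPoissonProcess P r N) (t : ℝ≥0) :
    HasLaw (N t) (poissonMeasure (r * t).toNNReal) P := by
  have h := hN.increment_law 0 t zero_le
  simp only [NNReal.coe_zero, sub_zero] at h
  refine ⟨(hN.measurable t).aemeasurable, ?_⟩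
  rw [← h.map_eq]
  refine Measure.map_congr ?_
  filter_upwards [hN.zero] with ω hω
  simp [hω]

lemma IsPoissonProcess.ae_unbounded [IsProbabilityMeasure P] (hN : IsPoissonProcess P r N)
    (hr : 0 < r) :
    ∀ᵐ ω ∂P, ∀ k, ∃ t, k < N t ω := by
  rw [ae_all_iff]
  intro k
  have hle : ∀ n : ℕ, P.real {ω | ∀ t, N t ω ≤ k} ≤ 2 ^ k * Real.exp (-(r / 2 * n)) := fun n => by
    calc P.real {ω | ∀ t, N t ω ≤ k} ≤ P.real {ω | N n ω ≤ k} :=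
          measureReal_mono (fun ω hω => hω n) (measure_ne_top _ _)
      _ = (poissonMeasure (r * (n : ℝ≥0)).toNNReal).real {n | n ≤ k} :=
          (hN.hasLaw n).measureReal_eq (p := fun n => n ≤ k) .of_discrete
      _ ≤ _ := by
          refine (poissonMeasure_real_le_le _ _).trans_eq ?_
          rw [Real.coe_toNNReal _ (by positivity)]
          congr 2
          push_cast
          ring
  have hlim : Filter.Tendsto (fun n : ℕ => 2 ^ k * Real.exp (-(r / 2 * n))) Filter.atTop
      (nhds 0) := by
    have : Filter.Tendsto (fun n : ℕ => r / 2 * (n : ℝ)) Filter.atTop Filter.atTop :=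
      tendsto_natCast_atTop_atTop.const_mul_atTop (by positivity)
    simpa using (Real.tendsto_exp_neg_atTop_nhds_zero.comp this).const_mul (2 ^ k : ℝ)
  have h0 : P.real {ω | ∀ t, N t ω ≤ k} = 0 :=
    le_antisymm (ge_of_tendsto' hlim hle) measureReal_nonneg
  filter_upwards [measure_eq_zero_iff_ae_notMem.1 ((measureReal_eq_zero_iff (measure_ne_top _ _)).1 h0)] with ω hω
  simpa using hω

/-- A Poisson process takes every value: at the first time where it is at least `k`, right
continuity gives `k ≤ N t`, and unit jumps give `N t ≤ k`. -/
lemma IsPoissonProcess.ae_surjective [IsProbabilityMeasure P] (hN : IsPoissonProcess P r N)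
    (hr : 0 < r) :
    ∀ᵐ ω ∂P, ∀ k, ∃ t, N t ω = k := by
  filter_upwards [hN.ae_unbounded hr, hN.zero, hN.mono, hN.right_cont, hN.unit_jumps]
    with ω hunb hzero hmono hrc hjump k
  set A : Set ℝ≥0 := {t | k ≤ N t ω} with hA
  have hne : A.Nonempty := (hunb k).imp fun t ht => ht.le
  set t := sInf A with ht
  have hlt : ∀ s < t, N s ω < k := fun s hs => not_le.1 fun h =>
    notMem_of_lt_csInf hs (OrderBot.bddBelow _) h
  have hge : k ≤ N t ω := by
    have hev : ∀ᶠ s in nhdsWithin t (Set.Ici t), N s ω = N t ω :=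
      (hrc t).eventually (discreteTopology_iff_singleton_mem_nhds.1 inferInstance (N t ω))
    obtain ⟨u, hu, hu'⟩ := (mem_nhdsGE_iff_exists_Ico_subset).1 hev
    obtain ⟨s, hsA, hsu⟩ := exists_lt_of_csInf_lt hne (show sInf A < u from hu)
    rw [← hu' ⟨csInf_le (OrderBot.bddBelow _) hsA, hsu⟩]
    exact hsA
  refine ⟨t, le_antisymm ?_ hge⟩
  rcases eq_or_lt_of_le (zero_le (a := t)) with h0 | h0
  · rw [← h0, hzero]; exact Nat.zero_le k
  · obtain ⟨s, hs, hs'⟩ := hjump t h0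
    have := hlt s hs
    omega

end poisson

/-! ### Averaging over an independent integer -/

section mixture

/-- Conditioning on an independent integer: the probability that a random element lies in a set
selected by `N` is the average, over the law of `N`, of the probabilities of the sets. -/
lemma measureReal_mem_of_indepFun {Ω E : Type*} [MeasurableSpace Ω] [MeasurableSpace E]
    {P : Measure Ω} [IsProbabilityMeasure P] {μ : Measure E} {ρ : Measure ℕ}
    {W : Ω → E} {N : Ω → ℕ} (hW : HasLaw W μ P) (hN : HasLaw N ρ P) (hind : IndepFun N W P)
    {B : ℕ → Set E} (hB : ∀ n, MeasurableSet (B n)) :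
    P.real {ω | W ω ∈ B (N ω)} = ∫ n, μ.real (B n) ∂ρ := by
  have : IsProbabilityMeasure μ := hW.map_eq ▸ Measure.isProbabilityMeasure_map hW.aemeasurable
  have : IsProbabilityMeasure ρ := hN.map_eq ▸ Measure.isProbabilityMeasure_map hN.aemeasurable
  have hS : MeasurableSet {p : ℕ × E | p.2 ∈ B p.1} := by
    have : {p : ℕ × E | p.2 ∈ B p.1} = ⋃ n, {n} ×ˢ B n := by
      ext ⟨n, e⟩; simp
    rw [this]
    exact .iUnion fun n => (measurableSet_singleton n).prod (hB n)
  have hmap := (indepFun_iff_map_prod_eq_prod_map_map hN.aemeasurable hW.aemeasurable).1 hind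
  rw [hN.map_eq, hW.map_eq] at hmap
  have h1 : P {ω | W ω ∈ B (N ω)} = (ρ.prod μ) {p : ℕ × E | p.2 ∈ B p.1} := by
    rw [← hmap, Measure.map_apply_of_aemeasurable (hN.aemeasurable.prodMk hW.aemeasurable) hS]
    rfl
  rw [measureReal_def, h1, Measure.prod_apply hS]
  exact (integral_toReal (Measurable.of_discrete).aemeasurable
    (.of_forall fun n => measure_lt_top _ _)).symm

end mixture

/-! ### The mid argmin of a two-sided step path -/

section path

/-- The two-sided step function that takes the values `s 0, s 1, …` to the right of the origin and
`u 0, u 1, …` to the left, the index at `t` being counted by `a` and `b`. -/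
noncomputable def stepPath (s u : ℕ → ℝ) (a b : ℝ≥0 → ℕ) (t : ℝ) : ℝ :=
  if 0 ≤ t then s (a t.toNNReal) else u (b (-t).toNNReal)

variable {s u : ℕ → ℝ} {a b : ℝ≥0 → ℕ}

lemma stepPath_coe (t : ℝ≥0) : stepPath s u a b t = s (a t) := by
  simp [stepPath]

/-- If after time `x` the right-hand values reach a level below everything else, then all minimisers
lie to the right of `x`, and hence so does the mid argmin. -/
lemma lt_midArgmin_stepPath (hs : Filter.Tendsto s Filter.atTop Filter.atTop) (ha : Monotone a)
    (hsurj : ∀ k, ∃ t, a t = k) {x : ℝ≥0} {m : ℕ} (hm : a x < m)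
    (hrec : ∀ j, j < m → s m < s j) (hdom : ∀ i, ∃ j, s j < u i) :
    (x : ℝ) < midArgmin (stepPath s u a b) := by
  obtain ⟨k, hk, hk'⟩ := exists_last_min hs
  have hmk : m ≤ k := not_lt.1 fun h => absurd (hk m) (not_le.2 (hrec k h))
  obtain ⟨t, ht⟩ := hsurj k
  have hmin : ∀ y, s k ≤ stepPath s u a b y := fun y => by
    unfold stepPath
    split_ifs
    · exact hk _
    · obtain ⟨j, hj⟩ := hdom (b (-y).toNNReal)
      exact (hk j).trans hj.le
  have htm : (t : ℝ) ∈ argminSet (stepPath s u a b) := fun y => by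
    rw [stepPath_coe, ht]
    exact hmin y
  have hval : ∀ y ∈ argminSet (stepPath s u a b),
      ∃ y' : ℝ≥0, (y' : ℝ) = y ∧ s (a y') = s k := by
    intro y hy
    have h1 : stepPath s u a b y = s k :=
      le_antisymm ((hy t).trans_eq (by rw [stepPath_coe, ht])) (hmin y)
    by_cases h0 : 0 ≤ y
    · lift y to ℝ≥0 using h0
      exact ⟨y, rfl, by rw [← h1, stepPath_coe]⟩
    · obtain ⟨j, hj⟩ := hdom (b (-y).toNNReal)
      rw [stepPath, if_neg h0] at h1
      exact absurd (hk j) (not_le.2 (h1 ▸ hj))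
  have hgt : ∀ y ∈ argminSet (stepPath s u a b), (x : ℝ) < y := by
    intro y hy
    obtain ⟨y', rfl, hy'⟩ := hval y hy
    have h1 : m ≤ a y' := not_lt.1 fun h =>
      absurd (hk m) (not_le.2 (hy' ▸ hrec _ h))
    rw [NNReal.coe_lt_coe]
    exact not_le.1 fun h => absurd (ha h) (not_le.2 (hm.trans_le h1))
  obtain ⟨T, hT⟩ := hsurj (k + 1)
  have hbdd : BddAbove (argminSet (stepPath s u a b)) := by
    refine ⟨T, fun y hy => ?_⟩
    obtain ⟨y', rfl, hy'⟩ := hval y hy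
    rw [NNReal.coe_le_coe]
    refine not_lt.1 fun h => ?_
    have := ha h.le
    rw [hT] at this
    exact absurd hy' (hk' _ (by omega)).ne'
  have h1 := le_csInf ⟨_, htm⟩ fun y hy => (hgt y hy).le
  have h2 := (hgt _ htm).trans_le (le_csSup hbdd htm)
  unfold midArgmin
  linarith

/-- If the mid argmin exceeds `x > 0` then some minimiser does. The junk values of `sInf` and `sSup`
on empty or unbounded sets are `0`, hence at most `x`. -/
lemma exists_mem_argminSet_gt {f : ℝ → ℝ} {x : ℝ} (hx : 0 < x) (h : x < midArgmin f) :
    ∃ t ∈ argminSet f, x < t := by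
  by_contra! hcon
  have h1 : sSup (argminSet f) ≤ x := Real.sSup_le hcon hx.le
  have h2 : sInf (argminSet f) ≤ x := by
    rcases (argminSet f).eq_empty_or_nonempty with he | ⟨t, ht⟩
    · rw [he, Real.sInf_empty]; exact hx.le
    · by_cases hb : BddBelow (argminSet f)
      · exact (csInf_le hb ht).trans (hcon t ht)
      · rw [Real.sInf_of_not_bddBelow hb]; exact hx.le
  unfold midArgmin at h
  linarith

lemma exists_last_min_of_lt_midArgmin (hs : Filter.Tendsto s Filter.atTop Filter.atTop)
    (hs0 : s 0 = 0) (ha : Monotone a) (hsurj : ∀ k, ∃ t, a t = k) {x : ℝ≥0} (hx : 0 < x)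
    (h : (x : ℝ) < midArgmin (stepPath s u a b)) :
    ∃ k, a x ≤ k ∧ s k ≤ 0 ∧ ∀ j, k < j → s k < s j := by
  obtain ⟨y, hy, hxy⟩ := exists_mem_argminSet_gt (NNReal.coe_pos.2 hx) h
  lift y to ℝ≥0 using (x.2.trans hxy.le)
  obtain ⟨k, hk, hk'⟩ := exists_last_min hs
  refine ⟨k, ?_, hs0 ▸ hk 0, hk'⟩
  have hyk : s (a y) ≤ s k := by
    obtain ⟨t, ht⟩ := hsurj k
    have := hy t
    rwa [stepPath_coe, stepPath_coe, ht] at this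
  have h1 : a y ≤ k := not_lt.1 fun h => absurd hyk (not_le.2 (hk' _ h))
  exact (ha (NNReal.coe_lt_coe.1 hxy).le).trans h1

end path

/-! ### Tail bounds for two-sided compound Poisson processes -/

section process

variable {Ω : Type*} [MeasurableSpace Ω] {P : Measure Ω} [IsProbabilityMeasure P]
  {ν : Measure ℝ} [IsProbabilityMeasure ν] {r : ℝ} {X : ℝ → Ω → ℝ}

/-- What the tail bounds need from a two-sided compound Poisson process whose steps have positive
mean: for a given time `x`, a random family `W` of all the steps and an integer `N`, the number of
jumps in `[0, x]`, which are independent and have the expected laws, and almost sure properties of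
the paths. -/
lemma IsTwoSidedCPP.exists_path (hX : IsTwoSidedCPP P ν r X) (hr : 0 < r)
    (hint : Integrable (fun x => x) ν) (hpos : 0 < ∫ x, x ∂ν) (x : ℝ≥0) :
    ∃ (W : Ω → ℕ ⊕ ℕ → ℝ) (N : Ω → ℕ), Measurable W ∧ Measurable N ∧
      HasLaw W (iidLaw (ℕ ⊕ ℕ) ν) P ∧ HasLaw N (poissonMeasure (r * x).toNNReal) P ∧
      IndepFun N W P ∧
      ∀ᵐ ω ∂P, Filter.Tendsto (walkSum fun i => W ω (.inl i)) Filter.atTop Filter.atTop ∧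
        ∃ a b : ℝ≥0 → ℕ, Monotone a ∧ (∀ k, ∃ t, a t = k) ∧ a x = N ω ∧
          (fun t => X t ω) = stepPath (walkSum fun i => W ω (.inl i))
            (walkSum fun i => W ω (.inr i)) a b := by
  obtain ⟨Np, Nn, Zp, Zn, hNp, -, -, hZp, hZn, hind, hindN, hXeq⟩ := hX
  set W : Ω → ℕ ⊕ ℕ → ℝ := fun ω i => Sum.elim Zp Zn i ω with hWdef
  have hWm : Measurable W := measurable_pi_iff.2 fun i => by
    rcases i with i | i
    · exact (hZp i).1
    · exact (hZn i).1
  have hWlaw : HasLaw W (iidLaw (ℕ ⊕ ℕ) ν) P :=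
    hind.hasLaw_infinitePi (fun i => by
      rcases i with i | i
      · exact (hZp i).2
      · exact (hZn i).2) hWm.aemeasurable
  refine ⟨W, Np x, hWm, hNp.measurable x, hWlaw, hNp.hasLaw x, ?_, ?_⟩
  · exact (hindN.comp measurable_id
      (show Measurable fun p : (ℝ≥0 → ℕ) × (ℝ≥0 → ℕ) => p.1 x by fun_prop)).symm
  · have hlim : ∀ᵐ ω ∂P, Filter.Tendsto (walkSum fun i => W ω (.inl i))
        Filter.atTop Filter.atTop := by
      have h1 := ae_tendsto_walkSum ν hint hpos
      have hmp := measurePreserving_iidLaw_comp ν (Sum.inl_injective (α := ℕ) (β := ℕ))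
      have h2 := hmp.quasiMeasurePreserving.ae h1
      rw [← hWlaw.map_eq] at h2
      exact ae_of_ae_map hWm.aemeasurable h2
    filter_upwards [hlim, hNp.mono, hNp.ae_surjective hr] with ω h1 h2 h3
    exact ⟨h1, fun t => Np t ω, fun t => Nn t ω, h2, h3, rfl, funext fun t => hXeq t ω⟩

lemma measurableSet_mem_comp {E : Type*} [MeasurableSpace E] {W : Ω → E} {N : Ω → ℕ}
    (hW : Measurable W) (hN : Measurable N) {B : ℕ → Set E} (hB : ∀ n, MeasurableSet (B n)) :
    MeasurableSet {ω | W ω ∈ B (N ω)} := by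
  have : {ω | W ω ∈ B (N ω)} = ⋃ n, N ⁻¹' {n} ∩ W ⁻¹' B n := by
    ext ω; simp
  rw [this]
  exact .iUnion fun n => (hN (measurableSet_singleton n)).inter (hW (hB n))

lemma integrable_of_mem_unitInterval {ρ : Measure ℕ} [IsFiniteMeasure ρ] {f : ℕ → ℝ}
    (hf : ∀ n, 0 ≤ f n ∧ f n ≤ 1) : Integrable f ρ :=
  .of_bound (C := 1) (Measurable.of_discrete).aestronglyMeasurable (.of_forall fun n => by
    rw [Real.norm_of_nonneg (hf n).1]; exact (hf n).2)

/-- If the right-hand walk has a strict record at its first jump after `x` and from there on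
dominates the left-hand walk, the mid argmin exceeds `x`. -/
lemma IsTwoSidedCPP.integral_strictRecord_le (hX : IsTwoSidedCPP P ν r X) (hr : 0 < r)
    (hint : Integrable (fun x => x) ν) (hpos : 0 < ∫ x, x ∂ν) (x : ℝ≥0) :
    ∫ n, 1 / 2 * (iidLaw ℕ ν).real (strictRecord (n + 1)) ∂poissonMeasure (r * x).toNNReal ≤
      1 - midArgminCDF P X x := by
  obtain ⟨W, N, hWm, hNm, hW, hN, hind, hpath⟩ := hX.exists_path hr hint hpos x
  have hB : ∀ n, MeasurableSet (recordDominated (n + 1)) :=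
    fun n => measurableSet_recordDominated _
  have hG := measurableSet_mem_comp hWm hNm hB
  have hle : midArgminCDF P X x ≤ P.real {ω | W ω ∈ recordDominated (N ω + 1)}ᶜ := by
    refine ENNReal.toReal_mono (measure_ne_top _ _) (measure_mono_ae ?_)
    filter_upwards [hpath] with ω ⟨hlim, a, b, ha, hsurj, hax, heq⟩ hω hcon
    refine absurd (show midArgmin (fun t => X t ω) ≤ x from hω) (not_le.2 ?_)
    obtain ⟨hrec, hdom⟩ := hcon
    rw [heq]
    refine lt_midArgmin_stepPath hlim ha hsurj (m := N ω + 1) (by omega) hrec fun i => ?_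
    obtain ⟨j, hj⟩ := hdom i
    have h0 := hrec 0 (Nat.succ_pos _)
    refine ⟨N ω + 1 + j, ?_⟩
    rw [walkSum_add]
    simp only [walkSum_zero] at h0
    simp only [shiftLeft, Sum.map_inl, Sum.map_inr, id] at hj
    linarith
  rw [probReal_compl_eq_one_sub hG, measureReal_mem_of_indepFun hW hN hind hB] at hle
  have hmono : ∫ n, 1 / 2 * (iidLaw ℕ ν).real (strictRecord (n + 1))
        ∂poissonMeasure (r * x).toNNReal ≤
      ∫ n, (iidLaw (ℕ ⊕ ℕ) ν).real (recordDominated (n + 1))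
        ∂poissonMeasure (r * x).toNNReal := by
    refine integral_mono (integrable_of_mem_unitInterval fun n => ⟨by positivity, ?_⟩)
      (integrable_of_mem_unitInterval fun n => ⟨measureReal_nonneg, measureReal_le_one⟩)
      fun n => half_mul_le_measureReal_recordDominated ν (n + 1)
    linarith [measureReal_le_one (μ := iidLaw ℕ ν) (s := strictRecord (n + 1))]
  linarith

/-- If the mid argmin exceeds `x`, the last minimiser of the right-hand walk comes no earlier than
the last jump before `x`; geometric bounds on the walk then give a bound on the tail. -/
lemma IsTwoSidedCPP.one_sub_midArgminCDF_le (hX : IsTwoSidedCPP P ν r X) (hr : 0 < r)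
    (hint : Integrable (fun x => x) ν) (hpos : 0 < ∫ x, x ∂ν) {x : ℝ≥0} (hx : 0 < x)
    {s : ℝ} (hs0 : 0 ≤ s) (hs1 : s < 1)
    (hs : ∀ k, (iidLaw ℕ ν).real {z | walkSum z k ≤ 0} ≤ s ^ k) :
    1 - midArgminCDF P X x ≤ posProb ν / (1 - s) * Real.exp (-(r * x * (1 - s))) := by
  obtain ⟨W, N, hWm, hNm, hW, hN, hind, hpath⟩ := hX.exists_path hr hint hpos x
  set C : ℕ → Set (ℕ → ℝ) := fun n => ⋃ k, strictLater (n + k) ∩ {z | walkSum z (n + k) ≤ 0}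
  have hC : ∀ n, MeasurableSet (C n) := fun n => .iUnion fun k =>
    (measurableSet_strictLater _).inter (measurableSet_le (by fun_prop) (by fun_prop))
  set B : ℕ → Set (ℕ ⊕ ℕ → ℝ) := fun n => (fun e i => e (.inl i)) ⁻¹' C n
  have hB : ∀ n, MeasurableSet (B n) := fun n => measurableSet_preimage (by fun_prop) (hC n)
  have hBC : ∀ n, (iidLaw (ℕ ⊕ ℕ) ν).real (B n) = (iidLaw ℕ ν).real (C n) := fun n =>
    (measurePreserving_iidLaw_comp ν Sum.inl_injective).measureReal_preimage
      (hC n).nullMeasurableSet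
  have hCle : ∀ n, (iidLaw ℕ ν).real (C n) ≤ posProb ν / (1 - s) * s ^ n := by
    intro n
    have hgeo : HasSum (fun k => posProb ν * s ^ (n + k)) (posProb ν / (1 - s) * s ^ n) := by
      convert! (hasSum_geometric_of_lt_one hs0 hs1).mul_left (posProb ν * s ^ n) using 1
      · ext k; rw [pow_add]; ring
      · rw [div_eq_mul_inv]; ring
    have hp : 0 ≤ posProb ν := measureReal_nonneg
    refine ENNReal.toReal_le_of_le_ofReal ?_ ?_
    · have : 0 < 1 - s := by linarith
      positivity
    · rw [← hgeo.tsum_eq, ENNReal.ofReal_tsum_of_nonneg (fun k => by positivity) hgeo.summable]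
      refine (measure_iUnion_le _).trans (ENNReal.tsum_le_tsum fun k => ?_)
      rw [← ofReal_measureReal (measure_ne_top _ _)]
      refine ENNReal.ofReal_le_ofReal ?_
      rw [measureReal_strictLater_inter]
      exact mul_le_mul_of_nonneg_left (hs _) hp
  have hG := measurableSet_mem_comp hWm hNm hB
  have hle : P.real {ω | W ω ∈ B (N ω)}ᶜ ≤ midArgminCDF P X x := by
    refine ENNReal.toReal_mono (measure_ne_top _ _) (measure_mono_ae ?_)
    filter_upwards [hpath] with ω ⟨hlim, a, b, ha, hsurj, hax, heq⟩ hω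
    refine not_lt.1 fun hcon => hω ?_
    simp only [heq] at hcon
    obtain ⟨k, hk, hk0, hk'⟩ :=
      exists_last_min_of_lt_midArgmin hlim (walkSum_zero _) ha hsurj hx hcon
    rw [hax] at hk
    obtain ⟨l, rfl⟩ := Nat.exists_eq_add_of_le hk
    exact Set.mem_iUnion.2 ⟨l, hk', hk0⟩
  rw [probReal_compl_eq_one_sub hG, measureReal_mem_of_indepFun hW hN hind hB] at hle
  have hmono : ∫ n, (iidLaw (ℕ ⊕ ℕ) ν).real (B n) ∂poissonMeasure (r * x).toNNReal ≤
      ∫ n, posProb ν / (1 - s) * s ^ n ∂poissonMeasure (r * x).toNNReal :=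
    integral_mono (integrable_of_mem_unitInterval fun n => ⟨measureReal_nonneg, measureReal_le_one⟩)
      ((integrable_of_mem_unitInterval fun n => ⟨pow_nonneg hs0 n, pow_le_one₀ hs0 hs1.le⟩).const_mul _)
      fun n => (hBC n).trans_le (hCle n)
  rw [integral_const_mul, integral_pow_poissonMeasure, Real.coe_toNNReal _ (by positivity)] at hmono
  linarith

end process

/-! ### The error law with a power tail -/

section errorLaw

variable {Q : Measure ℝ} {γ : ℝ}

lemma IsPowerTailErrorLaw.measureReal_abs_le [IsProbabilityMeasure Q]
    (hQ : IsPowerTailErrorLaw Q γ) {t : ℝ} (ht : 0 ≤ t) :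
    Q.real {x | |x| ≤ t} = 1 - 1 / (1 + t ^ γ) := by
  have h : {x : ℝ | |x| ≤ t} = {x | t < |x|}ᶜ := by ext; simp
  rw [h, probReal_compl_eq_one_sub (measurableSet_lt (by fun_prop) (by fun_prop)), hQ.tail t ht]

lemma IsPowerTailErrorLaw.measureReal_lt_neg [IsProbabilityMeasure Q]
    (hQ : IsPowerTailErrorLaw Q γ) {t : ℝ} (ht : 0 ≤ t) :
    Q.real {x | x < -t} = 1 / (1 + t ^ γ) / 2 := by
  have h1 : Q.real {x | t < x} = Q.real {x | x < -t} := by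
    conv_lhs => rw [← hQ.symm]
    rw [map_measureReal_apply (s := {x | t < x}) measurable_neg measurableSet_Ioi]
    congr 1
    ext x
    exact lt_neg (a := t) (b := x)
  have h2 : {x : ℝ | t < |x|} = {x | t < x} ∪ {x | x < -t} := by
    ext x
    simp only [Set.mem_ofPred_eq, Set.mem_union, lt_abs]
    rw [lt_neg]
  have h3 := hQ.tail t ht
  rw [h2, measureReal_union (Set.disjoint_left.2 fun x hx hx' => by
    simp only [Set.mem_ofPred_eq] at hx hx'; linarith) (measurableSet_lt (by fun_prop) (by fun_prop)),
      h1] at h3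
  linarith

lemma IsPowerTailErrorLaw.integral_comp_neg (hQ : IsPowerTailErrorLaw Q γ) {f : ℝ → ℝ}
    (hf : Measurable f) : ∫ e, f (-e) ∂Q = ∫ e, f e ∂Q := by
  conv_rhs => rw [← hQ.symm]
  rw [integral_map (by fun_prop) hf.aestronglyMeasurable]

lemma IsPowerTailErrorLaw.integrable_id [IsProbabilityMeasure Q]
    (hQ : IsPowerTailErrorLaw Q γ) (hγ : 1 < γ) :
    Integrable (fun e => e) Q := by
  have hint : IntegrableOn (fun t : ℝ => 1 / (1 + t ^ γ)) (Set.Ioi 0) := by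
    rw [← Set.Ioc_union_Ioi_eq_Ioi zero_le_one]
    have hm : Measurable fun t : ℝ => 1 / (1 + t ^ γ) := by fun_prop
    refine IntegrableOn.union ?_ ?_
    · refine Measure.integrableOn_of_bounded (M := 1) (by simp) hm.aestronglyMeasurable ?_
      filter_upwards [ae_restrict_mem measurableSet_Ioc] with t ht
      have := Real.rpow_nonneg ht.1.le γ
      rw [Real.norm_of_nonneg (by positivity), div_le_one (by positivity)]
      linarith
    · refine (integrableOn_Ioi_rpow_of_lt (a := -γ) (by linarith) one_pos).mono'
        hm.aestronglyMeasurable ?_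
      filter_upwards [ae_restrict_mem measurableSet_Ioi] with t ht
      have ht0 : 0 < t := one_pos.trans ht
      have := Real.rpow_pos_of_pos ht0 γ
      rw [Real.norm_of_nonneg (by positivity), Real.rpow_neg ht0.le, ← one_div]
      gcongr
      linarith
  have hl : ∫⁻ e, ENNReal.ofReal |e| ∂Q = ∫⁻ t in Set.Ioi 0, ENNReal.ofReal (1 / (1 + t ^ γ)) := by
    rw [lintegral_eq_lintegral_meas_lt Q (.of_forall fun e => abs_nonneg e) (by fun_prop)]
    refine setLIntegral_congr_fun measurableSet_Ioi fun t ht => ?_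
    rw [← hQ.tail t (le_of_lt ht), ofReal_measureReal (measure_ne_top _ _)]
  refine ⟨by fun_prop, ?_⟩
  rw [hasFiniteIntegral_iff_norm]
  simp only [Real.norm_eq_abs]
  rw [hl]
  exact hint.lintegral_lt_top

lemma IsPowerTailErrorLaw.integral_id (hQ : IsPowerTailErrorLaw Q γ) : ∫ e, e ∂Q = 0 := by
  have h := hQ.integral_comp_neg (f := fun e => e) (by fun_prop)
  rw [integral_neg] at h
  linarith

/-- A walk with steps `ξ + μ` has a strict record at time `m` with probability at least of order
`m ^ (-γ)`. The factor `1 / m` of the cyclic lemma is compensated by the `m` choices for the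
position of the big jump in the Lévy inequality. -/
lemma IsPowerTailErrorLaw.le_measureReal_strictRecord [IsProbabilityMeasure Q]
    (hQ : IsPowerTailErrorLaw Q γ) {μ : ℝ}
    (hμ : 0 < μ) {m : ℕ} (hm : 1 ≤ m) :
    1 / (4 * (1 + (m * μ) ^ γ + m)) ≤
      (iidLaw ℕ (Q.map fun e => e + μ)).real (strictRecord m) := by
  have hmeas : Measurable fun e : ℝ => e + μ := by fun_prop
  have := Measure.isProbabilityMeasure_map (μ := Q) hmeas.aemeasurable
  have hm0 : (0 : ℝ) < m := by exact_mod_cast hm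
  have ht : 0 ≤ m * μ := by positivity
  set v := (m * μ) ^ γ with hv
  have hv0 : 0 < v := by positivity
  have h1 := measureReal_neg_le_mul_strictRecord (Q.map fun e => e + μ) m
  have h2 : (iidLaw ℕ (Q.map fun e => e + μ)).real {z | walkSum z m < 0} =
      (iidLaw ℕ Q).real {e | walkSum e m < -(m * μ)} := by
    rw [← (measurePreserving_iidLaw_map Q hmeas).measureReal_preimage
      (measurableSet_lt (by fun_prop) (by fun_prop)).nullMeasurableSet]
    congr 1
    ext e
    simp only [walkSum, Set.mem_preimage, Set.mem_ofPred_eq, Finset.sum_add_distrib,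
      Finset.sum_const, Finset.card_range, nsmul_eq_mul]
    constructor <;> intro h <;> linarith
  have h3 := sum_firstBigNeg_le hQ.symm (m * μ) m
  rw [← Finset.mul_sum, hQ.measureReal_lt_neg ht, hQ.measureReal_abs_le ht] at h3
  have h4 := mul_neg_geom_sum (1 - 1 / (1 + v)) m
  rw [sub_sub_cancel] at h4
  -- `(1 - u) ^ m ≤ 1 / (1 + m * u)` for `u = 1 / (1 + v)`
  have h5 : (1 - 1 / (1 + v)) ^ m * (1 + m * (1 / (1 + v))) ≤ 1 := by
    have hu0 : 0 ≤ 1 / (1 + v) := by positivity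
    have hu1 : 1 / (1 + v) ≤ 1 := by rw [div_le_one (by positivity)]; linarith
    calc _ ≤ (1 - 1 / (1 + v)) ^ m * (1 + 1 / (1 + v)) ^ m := by
          refine mul_le_mul_of_nonneg_left ?_ (pow_nonneg (by linarith) _)
          exact one_add_mul_le_pow (by linarith) m
      _ = (1 - (1 / (1 + v)) ^ 2) ^ m := by rw [← mul_pow]; ring
      _ ≤ 1 := pow_le_one₀ (by nlinarith) (by nlinarith)
  have h6 : m / (1 + v + m) ≤ 1 - (1 - 1 / (1 + v)) ^ m := by
    set w := (1 - 1 / (1 + v)) ^ m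
    have : w ≤ (1 + v) / (1 + v + m) := by
      rw [le_div_iff₀ (by positivity)]
      calc w * (1 + v + m) = w * (1 + m * (1 / (1 + v))) * (1 + v) := by field_simp
        _ ≤ 1 * (1 + v) := by gcongr
        _ = _ := one_mul _
    have h7 : (m : ℝ) / (1 + v + m) = 1 - (1 + v) / (1 + v + m) := by field_simp; ring
    linarith
  have h8 : m / (1 + v + m) / 4 ≤ m * (iidLaw ℕ (Q.map fun e => e + μ)).real (strictRecord m) := by
    rw [← h4] at h6
    linarith
  have h9 : m / (1 + v + m) / 4 = m * (1 / (4 * (1 + v + m))) := by field_simp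
  rw [h9] at h8
  exact le_of_mul_le_mul_left h8 hm0

lemma one_add_mul_rpow_add_le {μ : ℝ} (hμ : 0 < μ) (hγ : 1 ≤ γ) {m : ℝ} (hm : 1 ≤ m) :
    1 + (m * μ) ^ γ + m ≤ m ^ γ * ((1 + μ ^ (-γ)) * (1 + μ) ^ γ) := by
  have hm0 : 0 < m := by linarith
  have hmγ : m ≤ m ^ γ := by simpa using Real.rpow_le_rpow_of_exponent_le hm hγ
  have hv : 0 < μ ^ γ := by positivity
  have h1 : 1 + μ ^ γ ≤ (1 + μ) ^ γ := by
    simpa using Real.add_rpow_le_rpow_add zero_le_one hμ.le hγ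
  have h5 : 2 + μ ^ γ ≤ (1 + μ ^ (-γ)) * (1 + μ) ^ γ := by
    rw [Real.rpow_neg hμ.le]
    calc 2 + μ ^ γ ≤ (1 + (μ ^ γ)⁻¹) * (1 + μ ^ γ) := by
          have h2 : (μ ^ γ)⁻¹ * μ ^ γ = 1 := inv_mul_cancel₀ hv.ne'
          have h3 : 0 < (μ ^ γ)⁻¹ := by positivity
          nlinarith
      _ ≤ _ := by gcongr
  have h6 : (m * μ) ^ γ = m ^ γ * μ ^ γ := Real.mul_rpow hm0.le hμ.le
  rw [h6]
  nlinarith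

end errorLaw

/-! ### Hoeffding's inequality for the walk -/

section hoeffding

/-- Hoeffding's inequality for a walk with bounded steps of positive mean. -/
lemma measureReal_walkSum_nonpos_le {ν : Measure ℝ} [IsProbabilityMeasure ν] {δ : ℝ} (hδ : 0 < δ)
    (hν : ∀ᵐ x ∂ν, x ∈ Set.Icc (-δ) δ) (hpos : 0 < ∫ x, x ∂ν) (k : ℕ) :
    (iidLaw ℕ ν).real {z | walkSum z k ≤ 0} ≤
      Real.exp (-((∫ x, x ∂ν) ^ 2 / (2 * δ ^ 2))) ^ k := by
  set m := ∫ x, x ∂ν with hm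
  rcases Nat.eq_zero_or_pos k with rfl | hk
  · simp
  have hmp : ∀ i, MeasurePreserving (fun z : ℕ → ℝ => z i) (iidLaw ℕ ν) ν :=
    fun i => measurePreserving_eval_infinitePi (fun _ => ν) i
  have hi : iIndepFun (fun (i : ℕ) (e : ℕ → ℝ) => m - e i) (iidLaw ℕ ν) :=
    iIndepFun_infinitePi (X := fun _ x => m - x) (by fun_prop)
  have hE : ∀ i, ∫ z, z i ∂iidLaw ℕ ν = m := fun i => by
    rw [hm]
    conv_rhs => rw [← (hmp i).map_eq]
    rw [integral_map (hmp i).aemeasurable (by fun_prop)]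
  have hsub : ∀ i < k, HasSubgaussianMGF (fun e : ℕ → ℝ => m - e i) ((‖δ - -δ‖₊ / 2) ^ 2)
      (iidLaw ℕ ν) := fun i _ => by
    have := (hasSubgaussianMGF_of_mem_Icc (hmp i).aemeasurable
      ((hmp i).quasiMeasurePreserving.ae hν)).neg
    convert! this using 1
    ext e
    simp [hE]
  have h := HasSubgaussianMGF.measure_sum_range_ge_le_of_iIndepFun hi hsub
    (ε := k * m) (by positivity)
  have hset : {e : ℕ → ℝ | k * m ≤ ∑ i ∈ Finset.range k, (m - e i)} = {z | walkSum z k ≤ 0} := by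
    ext e
    simp [walkSum, Finset.sum_sub_distrib]
  rw [hset] at h
  refine h.trans_eq ?_
  rw [← Real.exp_nat_mul]
  congr 1
  have hk' : (k : ℝ) ≠ 0 := by positivity
  have hc : (((‖δ - -δ‖₊ / 2) ^ 2 : ℝ≥0) : ℝ) = δ ^ 2 := by
    push_cast
    rw [sub_neg_eq_add, ← two_mul, Real.norm_of_nonneg (by positivity)]
    ring
  rw [hc]
  field_simp

end hoeffding

/-! ### The steps of the two criteria -/

section steps

variable {Q : Measure ℝ} [IsProbabilityMeasure Q] {γ δ : ℝ}

@[fun_prop] lemma measurable_l1Step (δ : ℝ) : Measurable (l1Step δ) := by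
  unfold l1Step; fun_prop

@[fun_prop] lemma measurable_l2Step (δ : ℝ) : Measurable (l2Step δ) := by
  unfold l2Step; fun_prop

lemma l1Step_mem_Icc (hδ : 0 < δ) (e : ℝ) : l1Step δ e ∈ Set.Icc (-δ) δ := by
  have h := abs_le.1 (abs_abs_sub_abs_le_abs_sub (e + δ) e)
  rwa [add_sub_cancel_left, abs_of_pos hδ] at h

lemma integrable_l1Step (hδ : 0 < δ) : Integrable (l1Step δ) Q :=
  .of_mem_Icc (-δ) δ (by fun_prop) (.of_forall (l1Step_mem_Icc hδ))

lemma integral_l1Step_le (hδ : 0 < δ) : ∫ e, l1Step δ e ∂Q ≤ δ := by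
  refine (integral_mono (integrable_l1Step hδ) (integrable_const δ)
    fun e => (l1Step_mem_Icc hδ e).2).trans_eq ?_
  simp

/-- By symmetry the mean of `|ξ + δ| - |ξ|` is half the mean of `|ξ + δ| + |ξ - δ| - 2 * |ξ|`,
which is nonnegative and positive when `|ξ| < δ`. -/
lemma integral_l1Step_pos (hQ : IsPowerTailErrorLaw Q γ) (hδ : 0 < δ) :
    0 < ∫ e, l1Step δ e ∂Q := by
  have hneg : Integrable (fun e => l1Step δ (-e)) Q :=
    .of_mem_Icc (-δ) δ (by fun_prop) (.of_forall fun e => l1Step_mem_Icc hδ _)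
  have h1 : ∫ e, (l1Step δ e + l1Step δ (-e)) ∂Q = 2 * ∫ e, l1Step δ e ∂Q := by
    rw [integral_add (integrable_l1Step hδ) hneg, hQ.integral_comp_neg (by fun_prop)]
    ring
  have hval : ∀ e, l1Step δ e + l1Step δ (-e) = |e + δ| + |e - δ| - 2 * |e| := fun e => by
    rw [l1Step, l1Step, abs_neg, show -e + δ = -(e - δ) by ring, abs_neg]
    ring
  have hnn : ∀ e, 0 ≤ l1Step δ e + l1Step δ (-e) := fun e => by
    rw [hval]
    have := abs_add_le (e + δ) (e - δ)
    rw [show e + δ + (e - δ) = 2 * e by ring, abs_mul, abs_two] at this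
    linarith
  have h2 : 0 < ∫ e, (l1Step δ e + l1Step δ (-e)) ∂Q := by
    rw [integral_pos_iff_support_of_nonneg hnn ((integrable_l1Step hδ).add hneg)]
    have hsub : {x : ℝ | |x| ≤ δ / 2} ⊆
        Function.support fun e => l1Step δ e + l1Step δ (-e) := by
      intro e he
      rw [Function.mem_support, hval]
      have he' : |e| ≤ δ / 2 := he
      have := le_abs_self (e + δ)
      have := neg_le_abs (e - δ)
      intro h
      linarith
    refine lt_of_lt_of_le ?_ (measure_mono hsub)
    refine pos_iff_ne_zero.2 fun h0 => ?_
    have h3 := hQ.measureReal_abs_le (t := δ / 2) (by positivity)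
    rw [measureReal_def, h0, ENNReal.toReal_zero] at h3
    have h4 : 0 < (δ / 2) ^ γ := by positivity
    have h5 : 1 / (1 + (δ / 2) ^ γ) < 1 := by
      rw [div_lt_one (by positivity)]; linarith
    linarith
  linarith

end steps

/-! ### The constant `c₂` -/

section constants

lemma exp_neg_one_le_c2Const : Real.exp (-1) ≤ c2Const := by
  have : Nonempty (Set.Ici (1 : ℝ)) := ⟨⟨1, Set.self_mem_Ici⟩⟩
  refine le_ciInf fun ⟨x, hx⟩ => ?_
  have hx1 : (1 : ℝ) ≤ x := hx
  have hb : 1 - 1 / (1 + x) = x / (1 + x) := by field_simp; ring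
  simp only [hb]
  have hb0 : 0 < x / (1 + x) := by positivity
  rw [Real.rpow_def_of_pos hb0, Real.exp_le_exp]
  have h1 := Real.one_sub_inv_le_log_of_pos hb0
  have h2 : 1 - (x / (1 + x))⁻¹ = -(1 / x) := by field_simp; ring
  have h3 : -(1 / x) * (x - 1) = -1 + 1 / x := by field_simp; ring
  have h4 : 0 < 1 / x := by positivity
  nlinarith

lemma c2Const_le : c2Const ≤ (10 / 11) ^ 9 := by
  have hbdd : BddBelow (Set.range fun x : Set.Ici (1 : ℝ) =>
      (1 - 1 / (1 + (x : ℝ))) ^ ((x : ℝ) - 1)) := by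
    refine ⟨0, ?_⟩
    rintro _ ⟨⟨x, hx⟩, rfl⟩
    have hx1 : (1 : ℝ) ≤ x := hx
    refine Real.rpow_nonneg ?_ _
    rw [sub_nonneg, div_le_one (by positivity)]
    linarith
  refine (ciInf_le hbdd ⟨10, by norm_num⟩).trans_eq ?_
  rw [show ((10 : ℝ) - 1) = ((9 : ℕ) : ℝ) by norm_num, Real.rpow_natCast]
  norm_num

end constants

/-! ### The tails of the two limit laws -/

lemma integral_map_l1Step {Q : Measure ℝ} {δ : ℝ} :
    ∫ x, x ∂(Q.map (l1Step δ)) = ∫ e, l1Step δ e ∂Q :=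
  integral_map (by fun_prop) (by fun_prop)

section tails

variable {Ω : Type*} [MeasurableSpace Ω] {P : Measure Ω} [IsProbabilityMeasure P]
  {Q : Measure ℝ} [IsProbabilityMeasure Q] {γ δ r : ℝ} {X : ℝ → Ω → ℝ}

lemma integrable_map_l2Step (hQ : IsPowerTailErrorLaw Q γ) (hγ : 1 < γ) :
    Integrable (fun x => x) (Q.map (l2Step δ)) := by
  rw [integrable_map_measure (by fun_prop) (by fun_prop)]
  exact (hQ.integrable_id hγ).add (integrable_const (δ / 2))

lemma integral_map_l2Step (hQ : IsPowerTailErrorLaw Q γ) (hγ : 1 < γ) :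
    ∫ x, x ∂(Q.map (l2Step δ)) = δ / 2 := by
  rw [integral_map (by fun_prop) (by fun_prop)]
  simp only [l2Step]
  rw [integral_add (hQ.integrable_id hγ) (integrable_const _), hQ.integral_id]
  simp

/-- By Jensen's inequality for the convex function `a ↦ a ^ γ` of `(N + 1)⁻¹`, where `N` is Poisson. -/
lemma rpow_le_integral_inv_succ_rpow {y : ℝ≥0} (hy : 0 < y) (hγ : 1 ≤ γ) :
    ((1 - Real.exp (-y)) / y) ^ γ ≤ ∫ n : ℕ, (((n : ℝ) + 1)⁻¹) ^ γ ∂poissonMeasure y := by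
  have hb : ∀ n : ℕ, 0 ≤ ((n : ℝ) + 1)⁻¹ ∧ ((n : ℝ) + 1)⁻¹ ≤ 1 := fun n =>
    ⟨by positivity, inv_le_one_of_one_le₀ (by linarith [n.cast_nonneg (α := ℝ)])⟩
  rw [← integral_inv_succ_poissonMeasure hy]
  exact (convexOn_rpow hγ).map_integral_le (f := fun n : ℕ => ((n : ℝ) + 1)⁻¹)
    (g := fun a : ℝ => a ^ γ)
    (Real.continuous_rpow_const (by linarith)).continuousOn isClosed_Ici
    (.of_forall fun n => (hb n).1) (integrable_of_mem_unitInterval hb)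
    (integrable_of_mem_unitInterval fun n => ⟨Real.rpow_nonneg (hb n).1 _,
      Real.rpow_le_one (hb n).1 (hb n).2 (by linarith)⟩)

/-- The polynomial lower bound for the `ℓ₂` limit, before the constants are compared. -/
lemma le_one_sub_midArgminCDF_l2 (hQ : IsPowerTailErrorLaw Q γ) (hγ : 1 < γ) (hδ : 0 < δ)
    (hX : IsTwoSidedCPP P (Q.map (l2Step δ)) r X) (hr : 0 < r) {x : ℝ≥0} (hx : 0 < x) :
    1 / (8 * ((1 + (δ / 2) ^ (-γ)) * (1 + δ / 2) ^ γ)) *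
      ((1 - Real.exp (-(r * x))) / (r * x)) ^ γ ≤ 1 - midArgminCDF P X x := by
  have hμ : 0 < δ / 2 := by positivity
  set D := (1 + (δ / 2) ^ (-γ)) * (1 + δ / 2) ^ γ with hD
  have hD0 : 0 < D := by positivity
  have := Measure.isProbabilityMeasure_map (μ := Q) (measurable_l2Step δ).aemeasurable
  have hy : 0 < (r * x).toNNReal := Real.toNNReal_pos.2 (by positivity)
  have hy' : ((r * x).toNNReal : ℝ) = r * x := Real.coe_toNNReal _ (by positivity)
  have h1 := hX.integral_strictRecord_le hr (integrable_map_l2Step hQ hγ)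
    (by rw [integral_map_l2Step hQ hγ]; exact hμ) x
  have h2 := rpow_le_integral_inv_succ_rpow hy hγ.le
  rw [hy'] at h2
  refine le_trans ?_ h1
  refine (mul_le_mul_of_nonneg_left h2 (by positivity)).trans ?_
  rw [← integral_const_mul]
  refine integral_mono (Integrable.const_mul (integrable_of_mem_unitInterval fun n => ?_) _)
    (integrable_of_mem_unitInterval fun n => ⟨by positivity, ?_⟩) fun n => ?_
  · have h3 : ((n : ℝ) + 1)⁻¹ ≤ 1 :=
      inv_le_one_of_one_le₀ (by linarith [n.cast_nonneg (α := ℝ)])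
    exact ⟨by positivity, Real.rpow_le_one (by positivity) h3 (by linarith)⟩
  · linarith [measureReal_le_one (μ := iidLaw ℕ (Q.map (l2Step δ))) (s := strictRecord (n + 1))]
  · have h3 := hQ.le_measureReal_strictRecord hμ (m := n + 1) (by omega)
    have h4 := one_add_mul_rpow_add_le hμ hγ.le (m := ((n + 1 : ℕ) : ℝ))
      (by push_cast; linarith [n.cast_nonneg (α := ℝ)])
    rw [← hD] at h4
    have h5 : (0 : ℝ) < ((n + 1 : ℕ) : ℝ) := by positivity
    have h6 : 1 / (4 * (((n + 1 : ℕ) : ℝ) ^ γ * D)) ≤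
        (iidLaw ℕ (Q.map (l2Step δ))).real (strictRecord (n + 1)) := by
      refine le_trans ?_ h3
      gcongr
    have h7 : 1 / (8 * D) * (((n : ℝ) + 1)⁻¹) ^ γ =
        1 / 2 * (1 / (4 * (((n + 1 : ℕ) : ℝ) ^ γ * D))) := by
      push_cast
      rw [Real.inv_rpow (by positivity)]
      field_simp
      norm_num
    simp only
    rw [h7]
    linarith

/-- Since `y ≥ 1 + γ + log 2`, the factor lost in Jensen's inequality is at least
`1 - exp (-2) / 2`, which still exceeds `2 * c₂`. -/
lemma two_mul_c2Const_le {y : ℝ} (hγ : 1 ≤ γ) (hy : 1 + γ + Real.log 2 ≤ y) :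
    2 * c2Const ≤ (1 - Real.exp (-y)) ^ γ := by
  have hy0 : 0 < y := by linarith [Real.log_pos one_lt_two]
  have h1 : 1 - γ * Real.exp (-y) ≤ (1 - Real.exp (-y)) ^ γ := by
    have := one_add_mul_self_le_rpow_one_add (s := -Real.exp (-y))
      (by linarith [Real.exp_le_one_iff.2 (neg_nonpos.2 hy0.le)]) hγ
    rw [← sub_eq_add_neg] at this
    linarith
  have h2 : γ ≤ Real.exp (γ - 1) := by linarith [Real.add_one_le_exp (γ - 1)]
  have h3 : Real.exp (-y) ≤ Real.exp (-1 - γ) / 2 := by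
    rw [show Real.exp (-1 - γ) / 2 = Real.exp (-1 - γ - Real.log 2) by
      rw [Real.exp_sub _ (Real.log 2), Real.exp_log two_pos], Real.exp_le_exp]
    linarith
  have h4 : γ * Real.exp (-y) ≤ Real.exp (-2) / 2 := by
    calc γ * Real.exp (-y) ≤ Real.exp (γ - 1) * (Real.exp (-1 - γ) / 2) := by gcongr
      _ = Real.exp (-2) / 2 := by
        rw [← mul_div_assoc, ← Real.exp_add]
        ring_nf
  have h5 : Real.exp (-2) ≤ 1 / 7 := by
    rw [Real.exp_neg, ← one_div]
    refine one_div_le_one_div_of_le (by norm_num) ?_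
    rw [show (2 : ℝ) = 1 + 1 by norm_num, Real.exp_add]
    nlinarith [Real.exp_one_gt_d9]
  have h6 := c2Const_le
  norm_num at h6
  linarith

lemma integrable_map_l1Step (hδ : 0 < δ) : Integrable (fun x => x) (Q.map (l1Step δ)) := by
  rw [integrable_map_measure (by fun_prop) (by fun_prop)]
  exact integrable_l1Step hδ

/-- Hoeffding's inequality has an exponent four times the one needed, `q ^ 4` instead of `q`; this
compensates for the factor `1 / (1 - q)` of the geometric series in place of `q / (1 - q)`. -/
lemma one_div_one_sub_pow_four_le {q : ℝ} (hq : 7 / 8 ≤ q) (hq1 : q < 1) :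
    1 / (1 - q ^ 4) ≤ 1 / (q⁻¹ - 1) := by
  have hq0 : 0 < q := by linarith
  have h1 : 1 < q⁻¹ := (one_lt_inv₀ hq0).2 hq1
  refine one_div_le_one_div_of_le (by linarith) ?_
  have h2 : q⁻¹ - 1 = (1 - q) * q⁻¹ := by field_simp
  have h3 : q⁻¹ ≤ 8 / 7 := by
    rw [inv_le_comm₀ hq0 (by norm_num)]; linarith
  have h4 : q⁻¹ ≤ 1 + q + q ^ 2 + q ^ 3 := by nlinarith [pow_pos hq0 2, pow_pos hq0 3]
  rw [h2, show 1 - q ^ 4 = (1 - q) * (1 + q + q ^ 2 + q ^ 3) by ring]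
  exact mul_le_mul_of_nonneg_left h4 (by linarith)

/-- The exponential upper bound for the `ℓ₁` limit. -/
lemma one_sub_midArgminCDF_l1_le (hQ : IsPowerTailErrorLaw Q γ) (hδ : 0 < δ)
    (hX : IsTwoSidedCPP P (Q.map (l1Step δ)) r X) (hr : 0 < r) {x : ℝ≥0} (hx : 0 < x)
    {κ : ℝ} (hκ : κ = (∫ e, l1Step δ e ∂Q) ^ 2 / (8 * δ ^ 2)) :
    1 - midArgminCDF P X x ≤
      probWalkPos Q (l1Step δ) / (Real.exp κ - 1) *
        Real.exp (-(x * r * (1 - Real.exp (-κ)))) := by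
  have := Measure.isProbabilityMeasure_map (μ := Q) (measurable_l1Step δ).aemeasurable
  have hpos := integral_l1Step_pos hQ hδ
  set m := ∫ e, l1Step δ e ∂Q with hm
  have hmδ : m ≤ δ := integral_l1Step_le hδ
  have hκ0 : 0 < κ := by rw [hκ]; positivity
  have hκ1 : κ ≤ 1 / 8 := by
    rw [hκ, div_le_div_iff₀ (by positivity) (by norm_num)]
    nlinarith
  set q := Real.exp (-κ) with hq
  have hq0 : 0 < q := Real.exp_pos _
  have hq1 : q < 1 := by
    rw [hq, ← Real.exp_zero, Real.exp_lt_exp]; linarith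
  have hq7 : 7 / 8 ≤ q := by linarith [Real.add_one_le_exp (-κ)]
  have hqκ : Real.exp κ = q⁻¹ := by rw [hq, Real.exp_neg, inv_inv]
  have hq4 : Real.exp (-(m ^ 2 / (2 * δ ^ 2))) = q ^ 4 := by
    rw [hq, ← Real.exp_nat_mul, hκ]
    congr 1
    push_cast
    field_simp
    norm_num
  have hmean : ∫ x, x ∂(Q.map (l1Step δ)) = m := integral_map_l1Step
  have hae : ∀ᵐ x ∂(Q.map (l1Step δ)), x ∈ Set.Icc (-δ) δ :=
    (ae_map_iff (by fun_prop) measurableSet_Icc).2 (.of_forall (l1Step_mem_Icc hδ))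
  have hq41 : q ^ 4 ≤ q := by simpa using pow_le_pow_of_le_one hq0.le hq1.le (show 1 ≤ 4 by norm_num)
  have h := hX.one_sub_midArgminCDF_le hr (integrable_map_l1Step hδ) (by rw [hmean]; exact hpos) hx
    (s := q ^ 4) (by positivity) (by linarith) (fun k => by
      have := measureReal_walkSum_nonpos_le hδ hae (by rw [hmean]; exact hpos) k
      rwa [hmean, hq4] at this)
  rw [probWalkPos_eq_posProb Q (measurable_l1Step δ), hqκ]
  have hp : 0 ≤ posProb (Q.map (l1Step δ)) := measureReal_nonneg
  have h1 := one_div_one_sub_pow_four_le hq7 hq1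
  have hx0 : (0 : ℝ) < x := by exact_mod_cast hx
  refine h.trans (mul_le_mul ?_ ?_ (Real.exp_pos _).le ?_)
  · rw [div_eq_mul_one_div, div_eq_mul_one_div (b := q⁻¹ - 1)]
    exact mul_le_mul_of_nonneg_left h1 hp
  · rw [Real.exp_le_exp, mul_comm r]
    have : x * r * (1 - q) ≤ x * r * (1 - q ^ 4) := by gcongr
    linarith
  · have : 1 < q⁻¹ := (one_lt_inv₀ hq0).2 hq1
    exact div_nonneg hp (by linarith)

end tails

theorem theorem2p4 {Ω : Type*} [MeasurableSpace Ω] (P : Measure Ω) [IsProbabilityMeasure P]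
    (γ : ℝ) (hγ : 0 < γ)
    (Q : Measure ℝ) [IsProbabilityMeasure Q] (hQ : IsPowerTailErrorLaw Q γ)
    (α₀ β₀ d₀ : ℝ) (hαβ : α₀ ≠ β₀)
    (fX : ℝ → ℝ) (hfX : 0 < fX d₀)
    (X₁ X₂ : ℝ → Ω → ℝ)
    (hX₁ : IsTwoSidedCPP P (Q.map (l1Step |α₀ - β₀|)) (fX d₀) X₁)
    (hX₂ : IsTwoSidedCPP P (Q.map (l2Step |α₀ - β₀|)) (fX d₀) X₂)
    (μ₀ : ℝ) (hμ₀ : μ₀ = ∫ e, l1Step |α₀ - β₀| e ∂Q) :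
    (1 < γ →
      0 < c0Const Q γ (|α₀ - β₀| / 2) ∧
      ∀ x : ℝ, (k0Const γ (|α₀ - β₀| / 2) + γ + Real.log 2) / fX d₀ ≤ x →
        c0Const Q γ (|α₀ - β₀| / 2) / (2 * fX d₀ ^ γ) * x ^ (-γ) ≤ 1 - midArgminCDF P X₂ x) ∧
    (0 < μ₀ ∧ 0 < probWalkPos Q (l1Step |α₀ - β₀|) ∧
      ∀ x : ℝ, 0 < x →
        1 - midArgminCDF P X₁ x ≤
          probWalkPos Q (l1Step |α₀ - β₀|) / (Real.exp (μ₀ ^ 2 / (8 * (α₀ - β₀) ^ 2)) - 1) *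
            Real.exp (-(x * fX d₀ * (1 - Real.exp (-(μ₀ ^ 2 / (8 * (α₀ - β₀) ^ 2))))))) := by
  set δ := |α₀ - β₀| with hδ
  have hδ0 : 0 < δ := abs_pos.2 (sub_ne_zero.2 hαβ)
  have hδ2 : (α₀ - β₀) ^ 2 = δ ^ 2 := (sq_abs _).symm
  refine ⟨fun hγ1 => ?_, ?_, ?_, fun x hx => ?_⟩
  · have hμ : 0 < δ / 2 := by positivity
    have hmeas : Measurable fun e : ℝ => e + δ / 2 := by fun_prop
    have := Measure.isProbabilityMeasure_map (μ := Q) hmeas.aemeasurable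
    have hp0 : 0 < probWalkPos Q fun e => e + δ / 2 := by
      rw [probWalkPos_eq_posProb Q hmeas]
      refine posProb_pos _ (integrable_map_l2Step (δ := δ) hQ hγ1) ?_
      exact (integral_map_l2Step (δ := δ) hQ hγ1).symm ▸ hμ
    have hp1 : probWalkPos Q (fun e => e + δ / 2) ≤ 1 := measureReal_le_one
    have hc2 : 0 < c2Const := (Real.exp_pos _).trans_le exp_neg_one_le_c2Const
    have hc1 : 0 < c1Const γ (δ / 2) := by unfold c1Const; positivity
    refine ⟨by unfold c0Const; positivity, fun x hx => ?_⟩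
    have hk0 : 1 ≤ k0Const γ (δ / 2) := le_max_left _ _
    have hy : 1 + γ + Real.log 2 ≤ fX d₀ * x := by
      rw [div_le_iff₀ hfX] at hx
      linarith
    have hx0 : 0 < x := by
      refine pos_of_mul_pos_right (a := fX d₀) ?_ hfX.le
      linarith [Real.log_pos one_lt_two]
    lift x to ℝ≥0 using hx0.le
    refine le_trans ?_ (le_one_sub_midArgminCDF_l2 hQ hγ1 hδ0 hX₂ hfX (by exact_mod_cast hx0))
    have hexp : 0 ≤ 1 - Real.exp (-(fX d₀ * x)) := by
      have : 0 < fX d₀ * x := by positivity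
      linarith [Real.exp_le_one_iff.2 (neg_nonpos.2 this.le)]
    rw [Real.div_rpow hexp (by positivity), Real.mul_rpow hfX.le hx0.le, Real.rpow_neg hx0.le]
    have hc := two_mul_c2Const_le hγ1.le hy
    have hc0 : c0Const Q γ (δ / 2) ≤ c1Const γ (δ / 2) * c2Const := by
      rw [c0Const, div_le_iff₀ (by positivity)]
      exact mul_le_mul_of_nonneg_left (hp1.trans hγ1.le) (by positivity)
    have hf : 0 < fX d₀ ^ γ := by positivity
    have hxγ : 0 < (x : ℝ) ^ γ := by positivity
    calc c0Const Q γ (δ / 2) / (2 * fX d₀ ^ γ) * ((x : ℝ) ^ γ)⁻¹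
        ≤ c1Const γ (δ / 2) * ((1 - Real.exp (-(fX d₀ * x))) ^ γ / 2) / (2 * fX d₀ ^ γ) *
          ((x : ℝ) ^ γ)⁻¹ := by
          gcongr
          refine hc0.trans (mul_le_mul_of_nonneg_left ?_ hc1.le)
          linarith
      _ = _ := by
          unfold c1Const
          field_simp
          ring
  · rw [hμ₀]
    exact integral_l1Step_pos hQ hδ0
  · have := Measure.isProbabilityMeasure_map (μ := Q) (measurable_l1Step δ).aemeasurable
    rw [probWalkPos_eq_posProb Q (measurable_l1Step δ)]
    refine posProb_pos _ (integrable_map_l1Step hδ0) ?_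
    rw [integral_map_l1Step]
    exact integral_l1Step_pos hQ hδ0
  · lift x to ℝ≥0 using hx.le
    exact one_sub_midArgminCDF_l1_le hQ hδ0 hX₁ hfX (by exact_mod_cast hx) (by rw [hμ₀, hδ2])
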